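/- Let $H^{1/2}(-1,1)$ be the Sobolev–Slobodeckij space, with $\|v\|^2=\int_{-1}^1 v^2+\int_{-1}^1\!\int_{-1}^1\frac{|v(x)-v(y)|^2}{|x-y|^2}\,dx\,dy$, let $H^{-1/2}(-1,1)$ be its dual and $\langle\cdot,\cdot\rangle$ the duality product. For $t\in H^{-1/2}(-1,1)$, $t\le 0$ means $\langle t,v\rangle\le 0$ for all $v\in H^{1/2}(-1,1)$ with $v\ge 0$ a.e. For $t_1,t_2\in H^{-1/2}(-1,1)$ set $$S(t_1,t_2):=-\langle \log|x|*t_1,t_2\rangle,\qquad A(t_1,t_2):=\langle \mathrm{sgn}(x)*t_1,t_2\rangle,$$ where $t_1$ is extended by zero to $\mathbb{R}$ and the convolutions, taken in the sense of distributions, restrict to elements of $H^{1/2}(-1,1)$. Let $\boldsymbol\Lambda$ be a linear operator on the symmetric real $2\times2$ matrices that is symmetric for the Frobenius product and strongly elliptic: there is $\alpha>0$ with $\varepsilon:\boldsymbol\Lambda\varepsilon\ge\alpha\,\varepsilon:\varepsilon$ for all symmetric $\varepsilon$. Let $\mathscr C_1,\mathscr C_2,\mathscr C_3,\mathscr C_4\in\mathbb{R}$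 be the constants of the Neumann-to-Dirichlet operator of the homogeneous elastic half-plane $\mathbb{R}\times\{y<0\}$ with elastic moduli $\boldsymbol\Lambda$. These are the constants, uniquely determined by $\boldsymbol\Lambda$, such that, for all smooth surface tractions with normal and tangential components $t_n,t_t$ compactly supported in $(-1,1)$, every displacement $\mathbf u$ that is smooth up to the boundary, has at most linear growth at infinity, and is in equilibrium under these tractions without body forces (that is, $\boldsymbol\sigma:=\boldsymbol\Lambda\frac{\nabla\mathbf u+{}^t\nabla\mathbf u}{2}$ satisfies $\mathrm{div}\,\boldsymbol\sigma=0$ for $y<0$, and $\sigma_{xy}=t_t$, $\sigma_{yy}=t_n$ on $y=0$) has the boundary values $$u_n=u_y=-\mathscr C_1\log|x|*t_n-\mathscr C_2\log|x|*t_t-\mathscr C_3\,\mathrm{sgn}(x)*t_t+a_n,$$ $$u_t=u_x=-\mathscr C_4\log|x|*t_t-\mathscr C_2\log|x|*t_n+\mathscr C_3\,\mathrm{sgn}(x)*t_n+a_t,$$ with $a_n,a_t$ affine functions of $x$. For a constant friction coefficient $f\ge 0$, a sliding velocity $w\ne 0$ and an indentor shape $g\in H^{1/2}(-1,1)$, let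 $$a(t_1,t_2):=\bigl(\mathscr C_1-\mathrm{sgn}(w)f\mathscr C_2\bigr)S(t_1,t_2)+\mathrm{sgn}(w)f\mathscr C_3\,A(t_1,t_2),$$ and consider the steady sliding frictional contact problem $\mathscr P$: find $t_n\in H^{-1/2}(-1,1)$ with $t_n\le 0$ such that $$a(t_n,\hat t-t_n)\ge\langle g,\hat t-t_n\rangle\qquad\text{for all }\hat t\in H^{-1/2}(-1,1)\text{ with }\hat t\le 0.$$ Then: 1. If $\mathscr C_1-f|\mathscr C_2|>0$, then for every $w\neq0$ and every $g\in H^{1/2}(-1,1)$ problem $\mathscr P$ has exactly one solution. 2. If $\mathscr C_1-f|\mathscr C_2|\le 0$, then for every $w\ne 0$ in the direction for which $\mathrm{sgn}(w)\,\mathscr C_2=|\mathscr C_2|$ there is an indentor shape $g$, the restriction to $(-1,1)$ of a $C^\infty$ function on $\mathbb{R}$, for which problem $\mathscr P$ has no solution. -/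

import Mathlib

open MeasureTheory Set
open scoped ContDiff Convolution

noncomputable section

namespace SteadySliding

/-! ### The spaces `H^{1/2}(-1,1)` and `H^{-1/2}(-1,1)` -/

/-- Lebesgue measure on the open interval `(-1,1)`. -/
abbrev volI : Measure ℝ := volume.restrict (Ioo (-1 : ℝ) 1)

/-- `H^{1/2}(-1,1)` with the Sobolev–Slobodeckij (Gagliardo) norm
`‖v‖² = ∫ v² + ∫∫ |v x - v y|² / |x - y|² dx dy`.  A function `v ∈ L²(-1,1)` is stored together with
its difference quotient `(x, y) ↦ (v x - v y) / (x - y)`, required to be in `L²((-1,1)²)`; in this way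
the Hilbert space structure is the one inherited from `L²(-1,1) × L²((-1,1)²)`. -/
def HHalf : Submodule ℝ (WithLp 2 (Lp ℝ 2 volI × Lp ℝ 2 (volI.prod volI))) where
  carrier := {p | (p.snd : ℝ × ℝ → ℝ) =ᵐ[volI.prod volI]
    fun z => ((p.fst : ℝ → ℝ) z.1 - (p.fst : ℝ → ℝ) z.2) / (z.1 - z.2)}
  zero_mem' := by
    have h0 := Lp.coeFn_zero ℝ 2 volI
    have h1 := (Measure.quasiMeasurePreserving_fst (μ := volI) (ν := volI)).ae_eq_comp h0
    have h2 := (Measure.quasiMeasurePreserving_snd (μ := volI) (ν := volI)).ae_eq_comp h0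
    have h3 := Lp.coeFn_zero ℝ 2 (volI.prod volI)
    simp only [mem_ofPred_eq, WithLp.zero_fst, WithLp.zero_snd]
    filter_upwards [h1, h2, h3] with z h1 h2 h3
    simp only [Function.comp_apply] at h1 h2
    rw [h1, h2, h3]
    simp
  add_mem' := by
    intro p q hp hq
    have h0 := Lp.coeFn_add p.fst q.fst
    have h1 := (Measure.quasiMeasurePreserving_fst (μ := volI) (ν := volI)).ae_eq_comp h0
    have h2 := (Measure.quasiMeasurePreserving_snd (μ := volI) (ν := volI)).ae_eq_comp h0
    have h3 := Lp.coeFn_add p.snd q.snd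
    simp only [mem_ofPred_eq, WithLp.add_fst, WithLp.add_snd] at hp hq ⊢
    filter_upwards [h1, h2, h3, hp, hq] with z h1 h2 h3 hp hq
    simp only [Function.comp_apply, Pi.add_apply] at h1 h2 h3
    rw [h1, h2, h3, hp, hq]
    ring
  smul_mem' := by
    intro c p hp
    have h0 := Lp.coeFn_smul c p.fst
    have h1 := (Measure.quasiMeasurePreserving_fst (μ := volI) (ν := volI)).ae_eq_comp h0
    have h2 := (Measure.quasiMeasurePreserving_snd (μ := volI) (ν := volI)).ae_eq_comp h0
    have h3 := Lp.coeFn_smul c p.snd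
    simp only [mem_ofPred_eq, WithLp.smul_fst, WithLp.smul_snd] at hp ⊢
    filter_upwards [h1, h2, h3, hp] with z h1 h2 h3 hp
    simp only [Function.comp_apply, Pi.smul_apply, smul_eq_mul] at h1 h2 h3
    rw [h1, h2, h3, hp]
    ring

/-- The underlying function of an element of `H^{1/2}(-1,1)` (defined almost everywhere). -/
def HHalf.toFun (v : HHalf) : ℝ → ℝ := (v.1.fst : Lp ℝ 2 volI)

/-- `H^{-1/2}(-1,1)`, the dual space of `H^{1/2}(-1,1)`; the duality product is evaluation. -/
abbrev HMinusHalf : Type := StrongDual ℝ HHalf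

theorem memLp_of_contDiff {f : ℝ → ℝ} (hf : ContDiff ℝ 1 f) : MemLp f 2 volI := by
  obtain ⟨C, hC⟩ := (isCompact_Icc (a := (-1 : ℝ)) (b := 1)).exists_bound_of_continuousOn
    hf.continuous.continuousOn
  refine MemLp.of_bound hf.continuous.aestronglyMeasurable C ?_
  filter_upwards [ae_restrict_mem measurableSet_Ioo] with x hx
  exact hC x (Ioo_subset_Icc_self hx)

theorem memLp_quotient_of_contDiff {f : ℝ → ℝ} (hf : ContDiff ℝ 1 f) :
    MemLp (fun z : ℝ × ℝ => (f z.1 - f z.2) / (z.1 - z.2)) 2 (volI.prod volI) := by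
  obtain ⟨K, hK⟩ := hf.contDiffOn.exists_lipschitzOnWith (s := Icc (-1 : ℝ) 1) one_ne_zero
    (convex_Icc _ _) isCompact_Icc
  have hm : Measurable (fun z : ℝ × ℝ => (f z.1 - f z.2) / (z.1 - z.2)) := by
    have := hf.continuous.measurable
    fun_prop
  refine MemLp.of_bound hm.aestronglyMeasurable K ?_
  have hI : ∀ᵐ x ∂volI, x ∈ Ioo (-1 : ℝ) 1 := ae_restrict_mem measurableSet_Ioo
  filter_upwards [(Measure.quasiMeasurePreserving_fst (μ := volI) (ν := volI)).ae hI,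
    (Measure.quasiMeasurePreserving_snd (μ := volI) (ν := volI)).ae hI] with z h1 h2
  have h := hK.dist_le_mul _ (Ioo_subset_Icc_self h1) _ (Ioo_subset_Icc_self h2)
  rw [Real.dist_eq, Real.dist_eq] at h
  rw [Real.norm_eq_abs, abs_div]
  exact div_le_of_le_mul₀ (abs_nonneg _) K.2 h

/-- The restriction to `(-1,1)` of a `C¹` function on the line, as an element of `H^{1/2}(-1,1)`. -/
def HHalf.ofContDiff (f : ℝ → ℝ) (hf : ContDiff ℝ 1 f) : HHalf :=
  ⟨WithLp.toLp 2 ((memLp_of_contDiff hf).toLp f, (memLp_quotient_of_contDiff hf).toLp _), by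
    have h0 := (memLp_of_contDiff hf).coeFn_toLp
    have h1 := (Measure.quasiMeasurePreserving_fst (μ := volI) (ν := volI)).ae_eq_comp h0
    have h2 := (Measure.quasiMeasurePreserving_snd (μ := volI) (ν := volI)).ae_eq_comp h0
    have h3 := (memLp_quotient_of_contDiff hf).coeFn_toLp
    change (_ : ℝ × ℝ → ℝ) =ᵐ[volI.prod volI] _
    filter_upwards [h1, h2, h3] with z h1 h2 h3
    simp only [Function.comp_apply] at h1 h2
    refine h3.trans ?_
    rw [← h1, ← h2]
    rfl⟩

/-- `t ≤ 0` in `H^{-1/2}(-1,1)`. -/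
def HMinusHalf.Nonpos (t : HMinusHalf) : Prop :=
  ∀ v : HHalf, (∀ᵐ x ∂volI, 0 ≤ HHalf.toFun v x) → t v ≤ 0

/-! ### Convolution with the kernels `log |x|` and `sgn x` -/

/-- Smooth functions with compact support in `(-1,1)`. -/
structure IsTest (φ : ℝ → ℝ) : Prop where
  smooth : ContDiff ℝ ∞ φ
  compact : HasCompactSupport φ
  supp : tsupport φ ⊆ Ioo (-1 : ℝ) 1

def logKernel (x : ℝ) : ℝ := Real.log |x|

def sgnKernel (x : ℝ) : ℝ := Real.sign x

theorem locallyIntegrable_logKernel_neg : LocallyIntegrable (fun x => logKernel (-x)) := by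
  have h : (fun x => logKernel (-x)) = Real.log := by
    funext x
    simp [logKernel]
  rw [h]
  refine (locallyIntegrable_iff).2 fun k hk => ?_
  obtain ⟨r, hr⟩ := hk.isBounded.subset_closedBall 0
  rw [Real.closedBall_eq_Icc] at hr
  refine IntegrableOn.mono_set ?_ (hr.trans (Icc_subset_uIcc))
  exact (intervalIntegrable_iff' (by simp)).1 intervalIntegral.intervalIntegrable_log'

theorem locallyIntegrable_sgnKernel_neg : LocallyIntegrable (fun x => sgnKernel (-x)) := by
  have hm : Measurable (fun x => sgnKernel (-x)) := by
    unfold sgnKernel Real.sign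
    refine Measurable.ite (measurableSet_lt measurable_neg measurable_const) measurable_const
      (Measurable.ite (measurableSet_lt measurable_const measurable_neg) measurable_const
        measurable_const)
  refine (locallyIntegrable_const (1 : ℝ)).mono hm.aestronglyMeasurable (ae_of_all _ fun x => ?_)
  simp only [sgnKernel]
  obtain h | h | h := Real.sign_apply_eq (-x) <;> simp [h]

theorem contDiff_conv {k φ : ℝ → ℝ} (hk : LocallyIntegrable k) (hφ : IsTest φ) :
    ContDiff ℝ 1 (k ⋆[ContinuousLinearMap.mul ℝ ℝ] φ) :=
  hφ.compact.contDiff_convolution_right (n := 1) _ hk (hφ.smooth.of_le (mod_cast le_top))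

/-- `h ∈ H^{1/2}(-1,1)` is the restriction to `(-1,1)` of the convolution `k * t` in the sense of
distributions, where `t ∈ H^{-1/2}(-1,1)` is extended by zero to the line:
`⟨k * t, φ⟩ = ⟨t, ǩ * φ⟩` for all test functions `φ`, with `ǩ x = k (-x)`. -/
def IsConv (k : ℝ → ℝ) (hk : LocallyIntegrable (fun x => k (-x))) (t : HMinusHalf) (h : HHalf) :
    Prop :=
  ∀ (φ : ℝ → ℝ) (hφ : IsTest φ),
    ∫ x, HHalf.toFun h x * φ x ∂volI =
      t (HHalf.ofContDiff ((fun x => k (-x)) ⋆[ContinuousLinearMap.mul ℝ ℝ] φ) (contDiff_conv hk hφ))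

open Classical in
/-- The restriction of `k * t` to `(-1,1)` as an element of `H^{1/2}(-1,1)`; such an element is unique,
and for the kernels `log |x|` and `sgn x` it exists for every `t`. -/
def conv (k : ℝ → ℝ) (hk : LocallyIntegrable (fun x => k (-x))) (t : HMinusHalf) : HHalf :=
  if h : ∃ v, IsConv k hk t v then h.choose else 0

/-- `S(t₁,t₂) = -⟨log|x| * t₁, t₂⟩`. -/
def formS (t₁ t₂ : HMinusHalf) : ℝ := -t₂ (conv logKernel locallyIntegrable_logKernel_neg t₁)

/-- `A(t₁,t₂) = ⟨sgn(x) * t₁, t₂⟩`. -/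
def formA (t₁ t₂ : HMinusHalf) : ℝ := t₂ (conv sgnKernel locallyIntegrable_sgnKernel_neg t₁)

/-! ### The elastic half-plane and the four constants of its Neumann-to-Dirichlet operator -/

/-- Symmetric real `2 × 2` matrices. -/
def SymMat : Submodule ℝ (Matrix (Fin 2) (Fin 2) ℝ) where
  carrier := {A | A.IsSymm}
  zero_mem' := Matrix.isSymm_zero
  add_mem' := fun hA hB => hA.add hB
  smul_mem' := fun c _ hA => hA.smul c

/-- The Frobenius scalar product. -/
def frob (A B : SymMat) : ℝ := ∑ i, ∑ j, A.1 i j * B.1 i j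

/-- The closed half-plane `{(x, y) | y ≤ 0}`; its outward unit normal is `(0, 1)`.  Coordinate `0` is
tangential and coordinate `1` is normal. -/
def halfPlane : Set (Fin 2 → ℝ) := {p | p 1 ≤ 0}

/-- `∂ⱼ F` on the closed half-plane (one-sided on the boundary). -/
def pderiv (F : (Fin 2 → ℝ) → ℝ) (j : Fin 2) (p : Fin 2 → ℝ) : ℝ :=
  fderivWithin ℝ F halfPlane p (Pi.single j 1)

/-- The linearized strain `(∇u + ᵗ∇u) / 2`. -/
def strain (u : (Fin 2 → ℝ) → (Fin 2 → ℝ)) (p : Fin 2 → ℝ) : SymMat :=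
  ⟨Matrix.of fun i j => (pderiv (fun q => u q i) j p + pderiv (fun q => u q j) i p) / 2,
    Matrix.IsSymm.ext fun i j => by
      simp only [Matrix.of_apply]
      ring⟩

/-- The stress `σ(u) = Λ ε(u)`. -/
def stress (Λ : SymMat →ₗ[ℝ] SymMat) (u : (Fin 2 → ℝ) → (Fin 2 → ℝ)) (p : Fin 2 → ℝ) :
    Matrix (Fin 2) (Fin 2) ℝ := (Λ (strain u p)).1

/-- `u` is a displacement of the half-plane, smooth up to the boundary and of at most linear growth,
which is in equilibrium without body forces and under the surface traction `(tt, tn)`. -/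
structure IsEquilibrium (Λ : SymMat →ₗ[ℝ] SymMat) (tn tt : ℝ → ℝ)
    (u : (Fin 2 → ℝ) → (Fin 2 → ℝ)) : Prop where
  smooth : ContDiffOn ℝ ∞ u halfPlane
  growth : ∃ M : ℝ, ∀ p ∈ halfPlane, ‖u p‖ ≤ M * (1 + ‖p‖)
  div_stress : ∀ p, p 1 < 0 → ∀ i, ∑ j, pderiv (fun q => stress Λ u q i j) j p = 0
  traction_t : ∀ x : ℝ, stress Λ u ![x, 0] 0 1 = tt x
  traction_n : ∀ x : ℝ, stress Λ u ![x, 0] 1 1 = tn x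

/-- Four real constants. -/
structure Constants where
  (c₁ c₂ c₃ c₄ : ℝ)

instance : Nonempty Constants := ⟨⟨0, 0, 0, 0⟩⟩

/-- `c` is the quadruple of constants of the Neumann-to-Dirichlet operator of the half-plane: for
smooth tractions compactly supported in `(-1,1)`, equilibrium displacements exist and all have, up to
an affine function, the boundary values
`uₙ = -c₁ log|x| * tₙ - c₂ log|x| * tₜ - c₃ sgn(x) * tₜ`,
`uₜ = -c₄ log|x| * tₜ - c₂ log|x| * tₙ + c₃ sgn(x) * tₙ`. -/
def IsNeumannToDirichlet (Λ : SymMat →ₗ[ℝ] SymMat) (c : Constants) : Prop :=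
  ∀ tn tt : ℝ → ℝ, IsTest tn → IsTest tt →
    (∃ u, IsEquilibrium Λ tn tt u) ∧
    ∀ u, IsEquilibrium Λ tn tt u →
      (∃ a b : ℝ, ∀ x : ℝ, u ![x, 0] 1 =
        -c.c₁ * (logKernel ⋆[ContinuousLinearMap.mul ℝ ℝ] tn) x
        - c.c₂ * (logKernel ⋆[ContinuousLinearMap.mul ℝ ℝ] tt) x
        - c.c₃ * (sgnKernel ⋆[ContinuousLinearMap.mul ℝ ℝ] tt) x + (a + b * x)) ∧
      (∃ a b : ℝ, ∀ x : ℝ, u ![x, 0] 0 =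
        -c.c₄ * (logKernel ⋆[ContinuousLinearMap.mul ℝ ℝ] tt) x
        - c.c₂ * (logKernel ⋆[ContinuousLinearMap.mul ℝ ℝ] tn) x
        + c.c₃ * (sgnKernel ⋆[ContinuousLinearMap.mul ℝ ℝ] tn) x + (a + b * x))

/-- The constants of the Neumann-to-Dirichlet operator of the half-plane with elastic moduli `Λ`
(they exist and are unique for symmetric, strongly elliptic `Λ`). -/
def constants (Λ : SymMat →ₗ[ℝ] SymMat) : Constants :=
  Classical.epsilon (IsNeumannToDirichlet Λ)

/-! ### The steady sliding problem -/

/-- `a(t₁,t₂) = (C₁ - sgn(w) f C₂) S(t₁,t₂) + sgn(w) f C₃ A(t₁,t₂)`. -/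
def formSliding (Λ : SymMat →ₗ[ℝ] SymMat) (f w : ℝ) (t₁ t₂ : HMinusHalf) : ℝ :=
  ((constants Λ).c₁ - Real.sign w * f * (constants Λ).c₂) * formS t₁ t₂
    + Real.sign w * f * (constants Λ).c₃ * formA t₁ t₂

/-- `t` solves the steady sliding problem for the moduli `Λ`, the friction coefficient `f`, the sliding
velocity `w` and the indentor shape `g`. -/
def SolvesProblem (Λ : SymMat →ₗ[ℝ] SymMat) (f w : ℝ) (g : HHalf) (t : HMinusHalf) : Prop :=
  t.Nonpos ∧ ∀ s : HMinusHalf, s.Nonpos → (s - t) g ≤ formSliding Λ f w t (s - t)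

end SteadySliding

end

open SteadySliding

/-!
The elastic constants enter only through the two signs in the hypotheses; the proof rests on the
forms `S` and `A` alone.

Two points of `(-1,1)` differ by less than `2`, so that convolutions on `(-1,1)` see only the values of
a kernel on `(-2,2)` and can be expanded in Fourier series of period `4` (`hasSum_convolution`).  The
coefficients of `-log |x|` with respect to this period are `1 - log 2` for `n = 0` and
`Si (π |n|) / (π |n|)` otherwise, with `Si` the sine integral; they are positive and comparable to
`1 / (1 + |n|)` (`logCoeff_bounds`).  Those of `sgn x` are imaginary and `O(1 / (1 + |n|))`.

Trigonometric series with coefficients `zₙ` such that `∑ (1 + |n|) |zₙ|² < ∞` converge in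
`H^{1/2}(-1,1)` (`norm_sq_sum_mode_le`).  Conversely every `v ∈ H^{1/2}(-1,1)` has such an expansion,
given by the Fourier series of its even reflection to the circle of length `4`
(`summable_weighted_fcoeff_reflect`); the reflection does not increase distances, so that it does not
increase difference quotients in `h⁻¹`.  Both facts come from Parseval's identity for the increments
`u (x + h) - u x`, integrated against `h⁻²`.

Hence, with `Lₙ` the coefficients of `-log |x|`, the operator `E ψ = ∑ Re (√Lₙ ψₙ eₙ)` maps `ℓ²`
continuously onto `H^{1/2}(-1,1)` (`exists_log_synthesis`).  Its transpose `Eᵗ` embeds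
`H^{-1/2}(-1,1)` in `ℓ²` with closed range, and `S(t₁,t₂) = ⟪Eᵗ t₁, Eᵗ t₂⟫`,
`A(t₁,t₂) = ⟪M Eᵗ t₁, Eᵗ t₂⟫` with a bounded skew multiplier `M` (`exists_kernel_representation`).  So
`S` is coercive and `A(t,t) = 0`.

If `C₁ - f |C₂| > 0`, then the form `a` is coercive, and the theorem of Lions and Stampacchia applies.
If `C₁ - f |C₂| ≤ 0`, then `a(t,t) ≤ 0` in the direction considered, and there is no solution for the
shape `g = -1`: a solution satisfies `a(t,t) = ⟨g,t⟩ = -⟨1,t⟩ ≥ 0`, hence `⟨1,t⟩ = 0`, which together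
with `t ≤ 0` gives `t = 0`; but for `t = 0` the inequality fails at `t̂ = -1`.
-/

noncomputable section

namespace SteadySliding

open scoped RealInnerProductSpace ENNReal
open Filter Topology

/-! ### Variational inequalities and synthesis operators in Hilbert spaces -/

theorem hasSum_sq_norm {ι : Type*} (ψ : lp (fun _ : ι => ℂ) 2) :
    HasSum (fun i => ‖ψ i‖ ^ 2) (‖ψ‖ ^ 2) := by
  simpa using lp.hasSum_norm (p := 2) (by simp) ψ

/-- The multiplier with a bounded symbol, as an operator on `ℓ²`. -/
theorem exists_multiplier {ι : Type*} (c : ι → ℂ) {C : ℝ} (hc : ∀ i, ‖c i‖ ≤ C) :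
    ∃ M : lp (fun _ : ι => ℂ) 2 →L[ℝ] lp (fun _ : ι => ℂ) 2, ∀ ψ i, M ψ i = c i * ψ i := by
  have hle : ∀ (ψ : lp (fun _ : ι => ℂ) 2) i, ‖c i * ψ i‖ ^ 2 ≤ C ^ 2 * ‖ψ i‖ ^ 2 := fun ψ i => by
    rw [norm_mul, mul_pow]
    gcongr
    exact hc i
  have hmem : ∀ ψ : lp (fun _ : ι => ℂ) 2, Memℓp (fun i => c i * ψ i) 2 := fun ψ => by
    refine memℓp_gen ?_
    refine Summable.of_nonneg_of_le (fun _ => by positivity) (fun i => ?_)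
      ((hasSum_sq_norm ψ).summable.mul_left (C ^ 2))
    simpa using hle ψ i
  refine ⟨LinearMap.mkContinuous
    { toFun := fun ψ => ⟨fun i => c i * ψ i, hmem ψ⟩
      map_add' := fun ψ χ => by ext i; exact mul_add _ _ _
      map_smul' := fun a ψ => by
        ext i
        exact mul_smul_comm a (c i) (ψ i) } |C| fun ψ => ?_, fun ψ i => rfl⟩
  refine abs_le_of_sq_le_sq' ?_ (by positivity) |>.2
  rw [mul_pow, sq_abs]
  exact hasSum_le (hle ψ) (hasSum_sq_norm (⟨_, hmem ψ⟩ : lp (fun _ : ι => ℂ) 2))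
    ((hasSum_sq_norm ψ).mul_left _)

section Hilbert

variable {F : Type*} [NormedAddCommGroup F] [InnerProductSpace ℝ F] [CompleteSpace F]

/-- The metric projection onto a closed convex set, with its variational characterization. -/
theorem exists_projection_convex {K : Set F} (hne : K.Nonempty) (hcl : IsClosed K)
    (hconv : Convex ℝ K) :
    ∃ P : F → F, (∀ u, P u ∈ K) ∧ ∀ u, ∀ w ∈ K, ⟪u - P u, w - P u⟫ ≤ 0 := by
  have h : ∀ u : F, ∃ v ∈ K, ∀ w ∈ K, ⟪u - v, w - v⟫ ≤ 0 := fun u => by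
    obtain ⟨v, hv, h⟩ := exists_norm_eq_iInf_of_complete_convex hne hcl.isComplete hconv u
    exact ⟨v, hv, (norm_eq_iInf_iff_real_inner_le_zero hconv hv).1 h⟩
  choose P hP h using h
  exact ⟨P, hP, h⟩

/-- The theorem of Lions and Stampacchia: for small `r > 0` the solution is the unique fixed point of
the contraction `u ↦ P (u - r (B u - γ))`, where `P` is the projection onto `K`. -/
theorem existsUnique_variationalInequality {K : Set F} (hne : K.Nonempty) (hcl : IsClosed K)
    (hconv : Convex ℝ K) (B : F →L[ℝ] F) {α : ℝ} (hα : 0 < α)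
    (hB : ∀ x, α * ‖x‖ ^ 2 ≤ ⟪B x, x⟫) (γ : F) :
    ∃! p, p ∈ K ∧ ∀ q ∈ K, ⟪γ, q - p⟫ ≤ ⟪B p, q - p⟫ := by
  obtain ⟨P, hPK, hP⟩ := exists_projection_convex hne hcl hconv
  have hPne : ∀ u v, ‖P u - P v‖ ≤ ‖u - v‖ := fun u v => by
    have h1 := hP u (P v) (hPK v)
    have h2 := hP v (P u) (hPK u)
    have h3 : ‖P u - P v‖ ^ 2 ≤ ⟪u - v, P u - P v⟫ := by
      rw [← real_inner_self_eq_norm_sq]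
      have e : ⟪u - v, P u - P v⟫ - ⟪P u - P v, P u - P v⟫ =
          -(⟪u - P u, P v - P u⟫ + ⟪v - P v, P u - P v⟫) := by
        simp only [inner_sub_left, inner_sub_right]; ring
      linarith
    have h4 := real_inner_le_norm (u - v) (P u - P v)
    by_contra! h5
    have := norm_nonneg (u - v)
    nlinarith
  -- The step `r = α / C²` minimizes the bound `1 - 2 r α + r² C²` for `‖x - r • B x‖² / ‖x‖²`;
  -- the term `α` in `C` makes the minimum nonnegative.
  set C : ℝ := ‖B‖ + α with hC
  have hCα : α ≤ C := by have := norm_nonneg B; linarith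
  have hC0 : 0 < C := by linarith
  set r : ℝ := α / C ^ 2 with hr
  have hr0 : 0 < r := by positivity
  set k : ℝ := 1 - α ^ 2 / C ^ 2 with hk
  have hk1 : k < 1 := by have : 0 < α ^ 2 / C ^ 2 := by positivity
                         linarith
  have hk0 : 0 ≤ k := by
    have : α ^ 2 / C ^ 2 ≤ 1 := (div_le_one (by positivity)).2 (by gcongr)
    linarith
  have hstep : ∀ x : F, ‖x - r • B x‖ ≤ √k * ‖x‖ := fun x => by
    refine Real.le_sqrt_of_sq_le ?_ |>.trans_eq (?_ : √(k * ‖x‖ ^ 2) = _)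
    · rw [norm_sub_sq_real, inner_smul_right, norm_smul, mul_pow, Real.norm_eq_abs, sq_abs,
        real_inner_comm]
      have h1 : ‖B x‖ ≤ C * ‖x‖ := (B.le_opNorm x).trans (by gcongr; linarith)
      have h2 : ‖B x‖ ^ 2 ≤ C ^ 2 * ‖x‖ ^ 2 := by rw [← mul_pow]; gcongr
      have h3 := mul_le_mul_of_nonneg_left h2 (sq_nonneg r)
      have h4 := mul_le_mul_of_nonneg_left (hB x) hr0.le
      have h5 : r ^ 2 * C ^ 2 = r * α := by rw [hr]; field_simp
      have h6 : k = 1 - r * α := by rw [hk, hr]; ring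
      rw [h6]
      nlinarith
    · rw [Real.sqrt_mul hk0, Real.sqrt_sq (norm_nonneg x)]
  have hcontr : ContractingWith (Real.toNNReal √k) fun u => P (u - r • (B u - γ)) := by
    refine ⟨?_, LipschitzWith.of_dist_le_mul fun u v => ?_⟩
    · rw [Real.toNNReal_lt_one, Real.sqrt_lt' one_pos]; simpa using hk1
    · rw [dist_eq_norm, dist_eq_norm, Real.coe_toNNReal _ (Real.sqrt_nonneg _)]
      refine (hPne _ _).trans (le_trans (le_of_eq ?_) (hstep (u - v)))
      rw [map_sub]
      congr 1
      module
  have : Nonempty F := ⟨0⟩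
  have hp : P (hcontr.fixedPoint - r • (B hcontr.fixedPoint - γ)) = hcontr.fixedPoint :=
    hcontr.fixedPoint_isFixedPt
  refine existsUnique_of_exists_of_unique ⟨hcontr.fixedPoint, hp ▸ hPK _, fun q hq => ?_⟩ ?_
  · generalize hcontr.fixedPoint = p at hp
    have h := hP (p - r • (B p - γ)) q hq
    rw [hp, sub_sub_cancel_left, inner_neg_left, inner_smul_left, inner_sub_left] at h
    by_contra! h'
    have := mul_neg_of_pos_of_neg hr0 (sub_neg.2 h')
    simp only [conj_trivial] at h
    linarith
  · rintro p q ⟨hp, hp'⟩ ⟨hq, hq'⟩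
    have h1 := hp' q hq
    have h2 := hq' p hp
    have h3 := hB (p - q)
    have h4 : ⟪B (p - q), p - q⟫ = -(⟪B p, q - p⟫ + ⟪B q, p - q⟫) := by
      simp only [map_sub, inner_sub_left, inner_sub_right]; ring
    have h5 : ⟪γ, q - p⟫ = -⟪γ, p - q⟫ := by rw [← inner_neg_right, neg_sub]
    have h6 : ‖p - q‖ ^ 2 ≤ 0 := by
      by_contra! h6
      have := mul_pos hα h6
      linarith
    have h7 : ‖p - q‖ = 0 := by simpa using le_antisymm h6 (sq_nonneg _)
    exact sub_eq_zero.1 (norm_eq_zero.1 h7)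

/-- If finite combinations `∑ mᵢ zᵢ` are bounded by the `ℓ²` norm of the coefficients, then they
extend to a bounded synthesis operator on `ℓ²`. -/
theorem exists_synthesis {ι : Type*} (m : ι → ℂ →ₗ[ℝ] F) {C : ℝ}
    (hm : ∀ (s : Finset ι) (z : ι → ℂ), ‖∑ i ∈ s, m i (z i)‖ ^ 2 ≤ C * ∑ i ∈ s, ‖z i‖ ^ 2) :
    ∃ E : lp (fun _ : ι => ℂ) 2 →L[ℝ] F, ∀ ψ, HasSum (fun i => m i (ψ i)) (E ψ) := by
  have hC : ∀ (s : Finset ι) (z : ι → ℂ),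
      ‖∑ i ∈ s, m i (z i)‖ ≤ √(|C| * ∑ i ∈ s, ‖z i‖ ^ 2) := fun s z =>
    Real.le_sqrt_of_sq_le ((hm s z).trans (mul_le_mul_of_nonneg_right (le_abs_self C)
      (Finset.sum_nonneg fun _ _ => sq_nonneg _)))
  have hsum : ∀ ψ : lp (fun _ : ι => ℂ) 2, Summable fun i => m i (ψ i) := fun ψ => by
    rw [summable_iff_vanishing_norm]
    intro ε hε
    have hε' : 0 < ε ^ 2 / (|C| + 1) := by positivity
    obtain ⟨s, hs⟩ := summable_iff_vanishing_norm.1 (hasSum_sq_norm ψ).summable _ hε'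
    refine ⟨s, fun t ht => (hC t ψ).trans_lt ?_⟩
    have h := hs t ht
    rw [Real.norm_of_nonneg (Finset.sum_nonneg fun _ _ => sq_nonneg _)] at h
    rw [Real.sqrt_lt' hε]
    have h0 : 0 ≤ ∑ i ∈ t, ‖ψ i‖ ^ 2 := Finset.sum_nonneg fun _ _ => sq_nonneg _
    rw [lt_div_iff₀ (by positivity)] at h
    nlinarith
  have hbd : ∀ ψ : lp (fun _ : ι => ℂ) 2, ‖∑' i, m i (ψ i)‖ ≤ √|C| * ‖ψ‖ := fun ψ => by
    refine le_of_tendsto (hsum ψ).hasSum.norm (Filter.Eventually.of_forall fun s => ?_)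
    refine (hC s ψ).trans ?_
    rw [Real.sqrt_mul (abs_nonneg C)]
    refine mul_le_mul_of_nonneg_left ?_ (Real.sqrt_nonneg _)
    rw [Real.sqrt_le_left (norm_nonneg _)]
    exact sum_le_hasSum s (fun _ _ => sq_nonneg _) (hasSum_sq_norm ψ)
  refine ⟨LinearMap.mkContinuous
    { toFun := fun ψ => ∑' i, m i (ψ i)
      map_add' := fun ψ χ => by
        rw [← (hsum ψ).tsum_add (hsum χ)]
        simp
      map_smul' := fun c ψ => by
        rw [RingHom.id_apply, ← (hsum ψ).tsum_const_smul]
        exact tsum_congr fun i => (m i).map_smul c (ψ i) } _ hbd, fun ψ => (hsum ψ).hasSum⟩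

/-- The transpose of `E : F → H`, with values in `F` by the Riesz representation theorem. -/
def dualMap {H : Type*} [NormedAddCommGroup H] [NormedSpace ℝ H] (E : F →L[ℝ] H) :
    StrongDual ℝ H →L[ℝ] F :=
  LinearMap.mkContinuous
    { toFun := fun t => (InnerProductSpace.toDual ℝ F).symm (t.comp E)
      map_add' := fun t s => by rw [ContinuousLinearMap.add_comp, map_add]
      map_smul' := fun c t => by
        rw [ContinuousLinearMap.smul_comp, map_smulₛₗ]
        rfl } ‖E‖ fun t => by
    rw [mul_comm]
    exact ((InnerProductSpace.toDual ℝ F).symm.norm_map _).trans_le (t.opNorm_comp_le E)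

section DualMap

variable {H : Type*} [NormedAddCommGroup H] [NormedSpace ℝ H] (E : F →L[ℝ] H)

@[simp]
theorem inner_dualMap (t : StrongDual ℝ H) (ψ : F) : ⟪dualMap E t, ψ⟫ = t (E ψ) :=
  InnerProductSpace.toDual_symm_apply

theorem apply_eq_inner_dualMap (t : StrongDual ℝ H) (ψ : F) : t (E ψ) = ⟪ψ, dualMap E t⟫ := by
  rw [real_inner_comm, inner_dualMap]

variable [CompleteSpace H]

/-- The transpose of a surjective operator is bounded below, by the open mapping theorem. -/
theorem isClosedEmbedding_dualMap (hE : Function.Surjective E) :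
    Topology.IsClosedEmbedding (dualMap E) := by
  obtain ⟨C, hC, h⟩ := E.exists_preimage_norm_le hE
  refine AntilipschitzWith.isClosedEmbedding (K := C.toNNReal)
    ((dualMap E).antilipschitz_of_bound fun t => ?_) (dualMap E).uniformContinuous
  rw [Real.coe_toNNReal _ hC.le]
  refine t.opNorm_le_bound (by positivity) fun v => ?_
  obtain ⟨ψ, rfl, hψ⟩ := h v
  rw [← inner_dualMap]
  refine (abs_real_inner_le_norm _ _).trans ?_
  calc ‖dualMap E t‖ * ‖ψ‖ ≤ ‖dualMap E t‖ * (C * ‖E ψ‖) := by gcongr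
    _ = _ := by ring

/-- A variational inequality in a dual space for a form that, after the transpose of a surjective
operator, is a multiple of the inner product plus a skew form. -/
theorem existsUnique_variationalInequality_dual (hE : Function.Surjective E) {M : F →L[ℝ] F}
    (hM : ∀ ψ, ⟪M ψ, ψ⟫ = 0) {K : Set (StrongDual ℝ H)} (hne : K.Nonempty) (hcl : IsClosed K)
    (hconv : Convex ℝ K) {α : ℝ} (hα : 0 < α) (β : ℝ) (g : H) :
    ∃! t, t ∈ K ∧ ∀ s ∈ K, (s - t) g ≤ α * ⟪dualMap E t, dualMap E (s - t)⟫ +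
      β * ⟪M (dualMap E t), dualMap E (s - t)⟫ := by
  have hemb := isClosedEmbedding_dualMap E hE
  obtain ⟨γ, rfl⟩ := hE g
  set B := α • ContinuousLinearMap.id ℝ F + β • M
  have hB : ∀ ψ χ, ⟪B ψ, χ⟫ = α * ⟪ψ, χ⟫ + β * ⟪M ψ, χ⟫ := fun ψ χ => by
    simp [B, inner_add_left, real_inner_smul_left]
  have key := existsUnique_variationalInequality (hne.image (dualMap E))
    (hemb.isClosedMap _ hcl) (hconv.linear_image (dualMap E).toLinearMap) B hα
    (fun ψ => by rw [hB, hM, mul_zero, add_zero, real_inner_self_eq_norm_sq]) γ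
  have hiff : ∀ t, (t ∈ K ∧ ∀ s ∈ K, (s - t) (E γ) ≤ α * ⟪dualMap E t, dualMap E (s - t)⟫ +
      β * ⟪M (dualMap E t), dualMap E (s - t)⟫) ↔ (dualMap E t ∈ dualMap E '' K ∧
      ∀ q ∈ dualMap E '' K, ⟪γ, q - dualMap E t⟫ ≤ ⟪B (dualMap E t), q - dualMap E t⟫) :=
    fun t => by
      rw [hemb.injective.mem_set_image, forall_mem_image]
      refine and_congr Iff.rfl (forall₂_congr fun s _ => ?_)
      rw [hB, ← map_sub, apply_eq_inner_dualMap]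
  obtain ⟨p, ⟨⟨t, ht, rfl⟩, hp⟩, huniq⟩ := key
  refine ⟨t, (hiff t).2 ⟨⟨t, ht, rfl⟩, hp⟩, fun s hs => hemb.injective ?_⟩
  exact huniq _ ((hiff s).1 hs)

end DualMap

end Hilbert

/-! ### The space `H^{1/2}(-1,1)` -/

theorem HHalf.snd_ae_eq (v : HHalf) : (v.1.snd : ℝ × ℝ → ℝ) =ᵐ[volI.prod volI]
    fun z => (HHalf.toFun v z.1 - HHalf.toFun v z.2) / (z.1 - z.2) := v.2

theorem HHalf.ext_ae {v w : HHalf} (h : (HHalf.toFun v) =ᵐ[volI] (HHalf.toFun w)) : v = w := by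
  refine Subtype.ext (WithLp.ofLp_injective 2 (Prod.ext (Lp.ext h) (Lp.ext ?_)))
  have h1 := (Measure.quasiMeasurePreserving_fst (μ := volI) (ν := volI)).ae_eq_comp h
  have h2 := (Measure.quasiMeasurePreserving_snd (μ := volI) (ν := volI)).ae_eq_comp h
  refine (HHalf.snd_ae_eq v).trans (EventuallyEq.trans ?_ (HHalf.snd_ae_eq w).symm)
  filter_upwards [h1, h2] with z h1 h2
  simp only [Function.comp_apply] at h1 h2
  rw [h1, h2]

theorem HHalf.toFun_ofContDiff (f : ℝ → ℝ) (hf : ContDiff ℝ 1 f) :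
    HHalf.toFun (HHalf.ofContDiff f hf) =ᵐ[volI] f :=
  (memLp_of_contDiff hf).coeFn_toLp

theorem HHalf.memLp_toFun (v : HHalf) : MemLp (HHalf.toFun v) 2 volI := Lp.memLp _

theorem isClosed_HHalf : IsClosed (HHalf : Set (WithLp 2 (Lp ℝ 2 volI × Lp ℝ 2 (volI.prod volI)))) := by
  refine isClosed_of_closure_subset fun p hp => ?_
  obtain ⟨u, hu, hlim⟩ := mem_closure_iff_seq_limit.1 hp
  have hf : Tendsto (fun n => (u n).fst) atTop (𝓝 p.fst) :=
    ((WithLp.prod_continuous_ofLp 2 _ _).fst.tendsto p).comp hlim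
  have hs : Tendsto (fun n => (u n).snd) atTop (𝓝 p.snd) :=
    ((WithLp.prod_continuous_ofLp 2 _ _).snd.tendsto p).comp hlim
  obtain ⟨a, ha, hfa⟩ := (tendstoInMeasure_of_tendsto_Lp hf).exists_seq_tendsto_ae
  obtain ⟨b, hb, hsb⟩ :=
    (tendstoInMeasure_of_tendsto_Lp (hs.comp ha.tendsto_atTop)).exists_seq_tendsto_ae
  have h1 := (Measure.quasiMeasurePreserving_fst (μ := volI) (ν := volI)).ae hfa
  have h2 := (Measure.quasiMeasurePreserving_snd (μ := volI) (ν := volI)).ae hfa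
  have h3 := ae_all_iff.2 fun n => HHalf.snd_ae_eq ⟨u n, hu n⟩
  change (p.snd : ℝ × ℝ → ℝ) =ᵐ[volI.prod volI] _
  filter_upwards [hsb, h1, h2, h3] with z hz h1 h2 h3
  refine tendsto_nhds_unique hz ?_
  simp only [Function.comp_apply, h3]
  exact ((h1.comp hb.tendsto_atTop).sub (h2.comp hb.tendsto_atTop)).div_const _

instance : CompleteSpace HHalf := isClosed_HHalf.completeSpace_coe

theorem ofReal_norm_sq_Lp {α : Type*} [MeasurableSpace α] {μ : Measure α} (f : Lp ℝ 2 μ) :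
    ENNReal.ofReal (‖f‖ ^ 2) = ∫⁻ x, ‖f x‖ₑ ^ 2 ∂μ := by
  rw [ENNReal.ofReal_pow (norm_nonneg _), ofReal_norm, Lp.enorm_def,
    eLpNorm_eq_lintegral_rpow_enorm_toReal (by simp) (by simp)]
  simp only [ENNReal.toReal_ofNat, ENNReal.rpow_ofNat]
  rw [← ENNReal.rpow_natCast, ← ENNReal.rpow_mul]
  norm_num

theorem HHalf.ofReal_norm_sq (v : HHalf) : ENNReal.ofReal (‖v‖ ^ 2) =
    (∫⁻ x, ‖HHalf.toFun v x‖ₑ ^ 2 ∂volI) +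
      ∫⁻ z, ‖(HHalf.toFun v z.1 - HHalf.toFun v z.2) / (z.1 - z.2)‖ₑ ^ 2 ∂(volI.prod volI) := by
  have h : ‖v‖ ^ 2 = ‖v.1.fst‖ ^ 2 + ‖v.1.snd‖ ^ 2 := WithLp.prod_norm_sq_eq_of_L2 v.1
  rw [h, ENNReal.ofReal_add (sq_nonneg _) (sq_nonneg _), ofReal_norm_sq_Lp, ofReal_norm_sq_Lp]
  congr 1
  refine lintegral_congr_ae ?_
  filter_upwards [(HHalf.snd_ae_eq v)] with z hz
  rw [hz]

theorem IsTest.memLp {φ : ℝ → ℝ} (hφ : IsTest φ) : MemLp φ 2 volI :=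
  memLp_of_contDiff (hφ.smooth.of_le (mod_cast le_top))

/-- `v ↦ ∫ v φ` as an element of `H^{-1/2}(-1,1)`. -/
def pairing {φ : ℝ → ℝ} (hφ : MemLp φ 2 volI) : HMinusHalf :=
  (innerSL ℝ (hφ.toLp φ)).comp
    ((ContinuousLinearMap.fst ℝ _ _ ∘L (WithLp.prodContinuousLinearEquiv 2 ℝ (Lp ℝ 2 volI)
      (Lp ℝ 2 (volI.prod volI))).toContinuousLinearMap) ∘L HHalf.subtypeL)

theorem pairing_apply {φ : ℝ → ℝ} (hφ : MemLp φ 2 volI) (v : HHalf) :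
    pairing hφ v = ∫ x, HHalf.toFun v x * φ x ∂volI := by
  change ⟪hφ.toLp φ, v.1.fst⟫ = _
  rw [L2.inner_def]
  refine integral_congr_ae ?_
  filter_upwards [hφ.coeFn_toLp] with x hx
  rw [hx]
  rfl

theorem HHalf.ext_test {v w : HHalf} (h : ∀ φ, IsTest φ →
    ∫ x, HHalf.toFun v x * φ x ∂volI = ∫ x, HHalf.toFun w x * φ x ∂volI) : v = w := by
  refine HHalf.ext_ae ?_
  have hi : ∀ u : HHalf, Integrable (HHalf.toFun u) volI := fun u => (HHalf.memLp_toFun u).integrable (by norm_num)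
  have h0 : ∀ᵐ x ∂volume, x ∈ Ioo (-1 : ℝ) 1 → ((HHalf.toFun v) - (HHalf.toFun w)) x = 0 := by
    refine isOpen_Ioo.ae_eq_zero_of_integral_contDiff_smul_eq_zero
      (IntegrableOn.locallyIntegrableOn ((hi v).sub (hi w))) fun φ hs hc hsupp => ?_
    have hφ : IsTest φ := ⟨hs, hc, hsupp⟩
    rw [← setIntegral_eq_integral_of_forall_compl_eq_zero (s := Ioo (-1 : ℝ) 1)]
    · have h1 : ∀ u : HHalf, Integrable (fun x => HHalf.toFun u x * φ x) volI := fun u =>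
        (HHalf.memLp_toFun u).integrable_mul hφ.memLp
      rw [← sub_eq_zero.2 (h φ hφ), ← integral_sub (h1 v) (h1 w)]
      refine integral_congr_ae (ae_of_all _ fun x => ?_)
      simp
      ring
    · intro x hx
      rw [image_eq_zero_of_notMem_tsupport fun hx' => hx (hsupp hx'), zero_smul]
  filter_upwards [ae_restrict_of_ae h0, ae_restrict_mem measurableSet_Ioo] with x hx hx'
  exact sub_eq_zero.1 (hx hx')

theorem IsConv.conv_eq {k : ℝ → ℝ} {hk : LocallyIntegrable (fun x => k (-x))} {t : HMinusHalf}
    {h : HHalf} (H : IsConv k hk t h) : conv k hk t = h := by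
  have hex : ∃ v, IsConv k hk t v := ⟨h, H⟩
  rw [conv, dif_pos hex]
  exact HHalf.ext_test fun φ hφ => (hex.choose_spec φ hφ).trans (H φ hφ).symm

/-- A vanishing value at the constant function `1` annihilates all bounded functions. -/
theorem HMinusHalf.Nonpos.eq_zero_of_bounded {t : HMinusHalf} (ht : t.Nonpos)
    (h1 : t (HHalf.ofContDiff (fun _ => 1) contDiff_const) = 0) {v : HHalf} {M : ℝ}
    (hv : ∀ᵐ x ∂volI, |HHalf.toFun v x| ≤ M) : t v = 0 := by
  set o := HHalf.ofContDiff (fun _ => (1 : ℝ)) contDiff_const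
  have ho : (HHalf.toFun o) =ᵐ[volI] fun _ => 1 := HHalf.toFun_ofContDiff _ _
  have hlin : ∀ c : ℝ, HHalf.toFun (M • o + c • v) =ᵐ[volI] fun x => M + c * HHalf.toFun v x := fun c => by
    have h2 := Lp.coeFn_add (M • o.1.fst) (c • v.1.fst)
    have h3 := Lp.coeFn_smul M o.1.fst
    have h4 := Lp.coeFn_smul c v.1.fst
    filter_upwards [ho, h2, h3, h4] with x h1 h2 h3 h4
    refine h2.trans ?_
    rw [Pi.add_apply, h3, h4]
    change M * HHalf.toFun o x + c * HHalf.toFun v x = _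
    rw [h1, mul_one]
  have hle : ∀ c : ℝ, |c| = 1 → c * t v ≤ 0 := fun c hc => by
    have h := ht (M • o + c • v) (by
      filter_upwards [hlin c, hv] with x hx hv
      rw [hx]
      have := neg_abs_le (c * HHalf.toFun v x)
      rw [abs_mul, hc] at this
      linarith)
    simpa [h1] using h
  have h2 := hle 1 (by simp)
  have h3 := hle (-1) (by simp)
  linarith

/-! ### Fourier series of period `4` -/

/-- The exponential `x ↦ exp (i π n x / 2)`, of period `4`. -/
def fexp (n : ℤ) (x : ℝ) : ℂ := Complex.exp ((Real.pi * n * x / 2 : ℝ) * Complex.I)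

@[simp]
theorem norm_fexp (n : ℤ) (x : ℝ) : ‖fexp n x‖ = 1 := Complex.norm_exp_ofReal_mul_I _

theorem fexp_add (n : ℤ) (x y : ℝ) : fexp n (x + y) = fexp n x * fexp n y := by
  rw [fexp, fexp, fexp, ← Complex.exp_add]
  congr 1
  push_cast
  ring

theorem fexp_neg_arg (n : ℤ) (x : ℝ) : fexp n (-x) = fexp (-n) x := by
  simp [fexp]

@[simp]
theorem fexp_zero (x : ℝ) : fexp 0 x = 1 := by simp [fexp]

theorem fexp_mul (m n : ℤ) (x : ℝ) : fexp m x * fexp n x = fexp (m + n) x := by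
  rw [fexp, fexp, fexp, ← Complex.exp_add]
  congr 1
  push_cast
  ring

@[simp]
theorem conj_fexp (n : ℤ) (x : ℝ) : (starRingEnd ℂ) (fexp n x) = fexp (-n) x := by
  rw [fexp, ← Complex.exp_conj, fexp]
  congr 1
  simp only [map_mul, Complex.conj_ofReal, Complex.conj_I]
  push_cast
  ring

theorem fexp_periodic (n : ℤ) : Function.Periodic (fexp n) 4 := fun x => by
  rw [fexp_add]
  have : fexp n 4 = 1 := by
    rw [fexp, Complex.exp_eq_one_iff]
    exact ⟨n, by push_cast; ring⟩
  rw [this, mul_one]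

theorem contDiff_fexp (n : ℤ) {k : WithTop ℕ∞} : ContDiff ℝ k (fexp n) := by
  unfold fexp
  refine ContDiff.cexp (ContDiff.mul ?_ contDiff_const)
  exact Complex.ofRealCLM.contDiff.comp ((contDiff_const.mul contDiff_id).div_const 2)

@[fun_prop]
theorem continuous_fexp (n : ℤ) : Continuous (fexp n) := (contDiff_fexp n (k := 0)).continuous

/-- The Fourier coefficient of a function on a period `(-2,2)`. -/
def fcoeff (f : ℝ → ℂ) (n : ℤ) : ℂ := (1 / 4) * ∫ x in (-2 : ℝ)..2, fexp (-n) x * f x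

theorem two_sub_neg_two_pos : (-2 : ℝ) < 2 := by norm_num

theorem fcoeff_eq_fourierCoeffOn (f : ℝ → ℂ) (n : ℤ) :
    fcoeff f n = fourierCoeffOn two_sub_neg_two_pos f n := by
  rw [fourierCoeffOn_eq_integral, fcoeff]
  rw [← Complex.coe_smul, smul_eq_mul]
  congr 1
  · norm_num
  · refine intervalIntegral.integral_congr fun x _ => ?_
    change _ = fourier (-n) ((x : ℝ) : AddCircle (2 - -2 : ℝ)) • f x
    rw [fourier_coe_apply, fexp, smul_eq_mul]
    congr 2
    push_cast
    ring

theorem hasSum_sq_fcoeff {f : ℝ → ℂ} (hf : MemLp f 2 (volume.restrict (Ioc (-2 : ℝ) 2))) :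
    HasSum (fun n => ‖fcoeff f n‖ ^ 2) ((1 / 4) * ∫ x in (-2 : ℝ)..2, ‖f x‖ ^ 2) := by
  have h := hasSum_sq_fourierCoeffOn two_sub_neg_two_pos hf
  simp only [fcoeff_eq_fourierCoeffOn]
  convert h using 1
  norm_num

/-- Parseval's identity for a pair of functions. -/
theorem hasSum_conj_fcoeff_mul_fcoeff {f g : ℝ → ℂ}
    (hf : MemLp f 2 (volume.restrict (Ioc (-2 : ℝ) 2)))
    (hg : MemLp g 2 (volume.restrict (Ioc (-2 : ℝ) 2))) :
    HasSum (fun n => (starRingEnd ℂ) (fcoeff f n) * fcoeff g n)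
      ((1 / 4) * ∫ x in (-2 : ℝ)..2, (starRingEnd ℂ) (f x) * g x) := by
  have : Fact (0 < (2 - -2 : ℝ)) := ⟨by norm_num⟩
  have hc : ∀ u : ℝ → ℂ, MemLp u 2 (volume.restrict (Ioc (-2 : ℝ) 2)) →
      MemLp u 2 (volume.restrict (Ioc (-2 : ℝ) (-2 + (2 - -2)))) := fun u hu => by
    rwa [add_sub_cancel]
  have h1 := (hc f hf).memLp_liftIoc.haarAddCircle
  have h2 := (hc g hg).memLp_liftIoc.haarAddCircle
  have hcoef : ∀ (u : ℝ → ℂ) (h : MemLp (AddCircle.liftIoc (2 - -2 : ℝ) (-2) u) 2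
      AddCircle.haarAddCircle) n, fourierCoeff (h.toLp _) n = fcoeff u n := fun u h n => by
    rw [fourierCoeff_congr_ae h.coeFn_toLp, fourierCoeff_liftIoc_eq, fcoeff_eq_fourierCoeffOn]
    simp
  have key := fourierBasis.hasSum_inner_mul_inner h1.toLp h2.toLp
  have h3 : ∀ n, inner ℂ (h1.toLp _) (fourierBasis n) * inner ℂ (fourierBasis n) (h2.toLp _) =
      (starRingEnd ℂ) (fcoeff f n) * fcoeff g n := fun n => by
    rw [← inner_conj_symm, ← fourierBasis.repr_apply_apply, ← fourierBasis.repr_apply_apply,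
      fourierBasis_repr, fourierBasis_repr, hcoef, hcoef]
  have h4 : ∫ a, inner ℂ (h1.toLp _ a) (h2.toLp _ a) ∂AddCircle.haarAddCircle =
      ∫ a, AddCircle.liftIoc (2 - -2 : ℝ) (-2) (fun x => (starRingEnd ℂ) (f x) * g x) a
        ∂AddCircle.haarAddCircle := by
    refine integral_congr_ae ?_
    filter_upwards [h1.coeFn_toLp, h2.coeFn_toLp] with x hx hx'
    rw [hx, hx']
    simp only [RCLike.inner_apply']
    rfl
  have h5 : inner ℂ (h1.toLp _) (h2.toLp _) =
      (1 / 4) * ∫ x in (-2 : ℝ)..2, (starRingEnd ℂ) (f x) * g x := by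
    rw [L2.inner_def, h4, AddCircle.integral_haarAddCircle,
      AddCircle.integral_liftIoc_eq_intervalIntegral, ← Complex.coe_smul, smul_eq_mul]
    norm_num
  rw [h5] at key
  simpa only [h3] using key

theorem integral_fexp {n : ℤ} (hn : n ≠ 0) : ∫ x in (-2 : ℝ)..2, fexp n x = 0 := by
  have hc : (Real.pi * n / 2 : ℂ) * Complex.I ≠ 0 := by
    simp [hn, Real.pi_ne_zero]
  have h : ∀ x : ℝ, fexp n x = Complex.exp ((Real.pi * n / 2 : ℂ) * Complex.I * x) := fun x => by
    rw [fexp]; congr 1; push_cast; ring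
  simp only [h]
  rw [integral_exp_mul_complex hc]
  rw [div_eq_zero_iff]
  left
  rw [← h, ← h]
  have := fexp_periodic n (-2)
  norm_num at this
  rw [this, sub_self]

theorem fcoeff_fexp (m n : ℤ) : fcoeff (fexp m) n = if m = n then 1 else 0 := by
  simp only [fcoeff, fexp_mul]
  split_ifs with h
  · subst h
    simp
    norm_num
  · rw [integral_fexp (by omega), mul_zero]

theorem memLp_period_of_continuous {f : ℝ → ℂ} (hf : Continuous f) :
    MemLp f 2 (volume.restrict (Ioc (-2 : ℝ) 2)) := by
  obtain ⟨C, hC⟩ := (isCompact_Icc (a := (-2 : ℝ)) (b := 2)).exists_bound_of_continuousOn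
    hf.continuousOn
  refine MemLp.of_bound hf.aestronglyMeasurable C ?_
  filter_upwards [ae_restrict_mem measurableSet_Ioc] with x hx
  exact hC x (Ioc_subset_Icc_self hx)

theorem fcoeff_trigSum (s : Finset ℤ) (z : ℤ → ℂ) (n : ℤ) :
    fcoeff (fun x => ∑ m ∈ s, z m * fexp m x) n = if n ∈ s then z n else 0 := by
  have : fcoeff (fun x => ∑ m ∈ s, z m * fexp m x) n = ∑ m ∈ s, z m * fcoeff (fexp m) n := by
    simp only [fcoeff, Finset.mul_sum]
    rw [intervalIntegral.integral_finsetSum, Finset.mul_sum]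
    · refine Finset.sum_congr rfl fun m _ => ?_
      simp only [mul_left_comm _ (z m)]
      rw [intervalIntegral.integral_const_mul, mul_left_comm]
    · intro m _
      refine Continuous.intervalIntegrable ?_ _ _
      fun_prop
  rw [this]
  simp [fcoeff_fexp]

theorem lintegral_period_eq {f : ℝ → ℂ} (hf : MemLp f 2 (volume.restrict (Ioc (-2 : ℝ) 2))) :
    ∫⁻ x in Ioc (-2 : ℝ) 2, ‖f x‖ₑ ^ 2 = ENNReal.ofReal (∫ x in (-2 : ℝ)..2, ‖f x‖ ^ 2) := by
  rw [intervalIntegral.integral_of_le (by norm_num), ofReal_integral_eq_lintegral_ofReal]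
  · simp [ENNReal.ofReal_pow]
  · exact hf.norm.integrable_sq
  · exact ae_of_all _ fun x => by positivity

theorem ofReal_four_mul_sum_sq (s : Finset ℤ) (z : ℤ → ℂ) :
    ENNReal.ofReal (4 * ∑ m ∈ s, ‖z m‖ ^ 2) = 4 * ∑ m ∈ s, ‖z m‖ₑ ^ 2 := by
  rw [ENNReal.ofReal_mul (by norm_num), ENNReal.ofReal_sum_of_nonneg fun _ _ => sq_nonneg _]
  simp [ENNReal.ofReal_pow]

theorem lintegral_trigSum (s : Finset ℤ) (z : ℤ → ℂ) :
    ∫⁻ x in Ioc (-2 : ℝ) 2, ‖∑ m ∈ s, z m * fexp m x‖ₑ ^ 2 =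
      4 * ∑ m ∈ s, ‖z m‖ₑ ^ 2 := by
  have hmem : MemLp (fun x => ∑ m ∈ s, z m * fexp m x) 2 (volume.restrict (Ioc (-2 : ℝ) 2)) :=
    memLp_period_of_continuous (by fun_prop)
  rw [lintegral_period_eq hmem, ← ofReal_four_mul_sum_sq]
  congr 1
  have h := hasSum_sq_fcoeff hmem
  simp only [fcoeff_trigSum] at h
  have h' : HasSum (fun n => ‖if n ∈ s then z n else 0‖ ^ 2)
      (∑ n ∈ s, ‖if n ∈ s then z n else 0‖ ^ 2) :=
    hasSum_sum_of_ne_finset_zero fun n hn => by simp [hn]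
  have h2 := h.unique h'
  rw [Finset.sum_congr rfl (fun n hn => by rw [if_pos hn] : ∀ n ∈ s, _ = ‖z n‖ ^ 2)] at h2
  linarith

/-- Bessel's inequality. -/
theorem sum_sq_fcoeff_le {f : ℝ → ℂ} (hf : MemLp f 2 (volume.restrict (Ioc (-2 : ℝ) 2)))
    (s : Finset ℤ) :
    4 * ∑ n ∈ s, ‖fcoeff f n‖ₑ ^ 2 ≤ ∫⁻ x in Ioc (-2 : ℝ) 2, ‖f x‖ₑ ^ 2 := by
  rw [lintegral_period_eq hf, ← ofReal_four_mul_sum_sq]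
  refine ENNReal.ofReal_le_ofReal ?_
  have := sum_le_hasSum s (fun n _ => sq_nonneg _) (hasSum_sq_fcoeff hf)
  linarith

theorem fcoeff_shift {f : ℝ → ℂ} (hf : Function.Periodic f 4) (h : ℝ) (n : ℤ) :
    fcoeff (fun x => f (x + h)) n = fexp n h * fcoeff f n := by
  simp only [fcoeff]
  have hp : Function.Periodic (fun x => fexp (-n) x * f x) 4 := fun x => by
    simp only [fexp_periodic (-n) x, hf x]
  have h1 : ∀ x, fexp (-n) x * f (x + h) = fexp n h * (fexp (-n) (x + h) * f (x + h)) := fun x => by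
    rw [fexp_add, ← mul_assoc, mul_left_comm, fexp_mul]
    simp
  simp only [h1]
  rw [intervalIntegral.integral_const_mul,
    intervalIntegral.integral_comp_add_right (fun x => fexp (-n) x * f x)]
  have h2 := hp.intervalIntegral_add_eq (-2 + h) (-2)
  norm_num at h2
  have h3 : -2 + h + 4 = 2 + h := by ring
  rw [h3] at h2
  rw [h2]
  ring

/-! ### Even reflection of the interval onto the circle of length `4` -/

theorem setLIntegral_period_eq {f : ℝ → ℝ≥0∞} (hf : Function.Periodic f 4) (a b : ℝ) :
    ∫⁻ x in Ioc a (a + 4), f x = ∫⁻ x in Ioc b (b + 4), f x := by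
  refine (isAddFundamentalDomain_Ioc (by norm_num : (0 : ℝ) < 4) a).setLIntegral_eq
    (isAddFundamentalDomain_Ioc (by norm_num : (0 : ℝ) < 4) b) f ?_
  rintro ⟨g, hg⟩ x
  obtain ⟨n, rfl⟩ := AddSubgroup.mem_zmultiples_iff.1 hg
  change f (n • 4 + x) = f x
  rw [add_comm]
  exact hf.zsmul n x

/-- The triangle wave of period `4` that is `x` on `[-1,1]` and `2 - x` on `[1,3]`. -/
def tri (x : ℝ) : ℝ := 1 - ‖((x - 1 : ℝ) : AddCircle (4 : ℝ))‖

theorem tri_periodic : Function.Periodic tri 4 := fun x => by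
  have h : ((x + 4 - 1 : ℝ) : AddCircle (4 : ℝ)) = ((x - 1 : ℝ) : AddCircle (4 : ℝ)) := by
    rw [add_sub_right_comm, AddCircle.coe_add_period]
  rw [tri, h, tri]

theorem tri_of_mem_Icc {x : ℝ} (hx : x ∈ Icc (-1 : ℝ) 1) : tri x = x := by
  have h : |x - 1| = 1 - x := by rw [abs_sub_comm, abs_of_nonneg (by linarith [hx.2])]
  rw [tri, (AddCircle.norm_coe_eq_abs_iff 4 (by norm_num)).2, h]
  · ring
  · rw [h, abs_of_pos (by norm_num)]
    linarith [hx.1]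

theorem tri_two_sub {x : ℝ} (hx : x ∈ Icc (-1 : ℝ) 1) : tri (2 - x) = x := by
  have h : |2 - x - 1| = 1 - x := by rw [abs_of_nonneg (by linarith [hx.2])]; ring
  rw [tri, (AddCircle.norm_coe_eq_abs_iff 4 (by norm_num)).2, h]
  · ring
  · rw [h, abs_of_pos (by norm_num)]
    linarith [hx.1]

theorem abs_tri_sub_tri_le (x y : ℝ) : |tri x - tri y| ≤ |x - y| := by
  have h : tri x - tri y = -(‖((x - 1 : ℝ) : AddCircle (4 : ℝ))‖ -
    ‖((y - 1 : ℝ) : AddCircle (4 : ℝ))‖) := by simp only [tri]; ring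
  rw [h, abs_neg]
  refine (abs_norm_sub_norm_le _ _).trans ?_
  rw [← AddCircle.coe_sub, sub_sub_sub_cancel_right]
  exact QuotientAddGroup.norm_mk_le_norm

theorem continuous_tri : Continuous tri :=
  LipschitzWith.continuous (K := 1) (LipschitzWith.of_dist_le_mul fun x y => by
    simpa [Real.dist_eq] using abs_tri_sub_tri_le x y)

theorem volI_eq_Ioc : volI = volume.restrict (Ioc (-1 : ℝ) 1) :=
  Measure.restrict_congr_set Ioo_ae_eq_Ioc

/-- The triangle wave covers the interval twice per period, preserving lengths. -/
theorem lintegral_comp_tri {G : ℝ → ℝ≥0∞} (hG : Measurable G) (c : ℝ) :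
    ∫⁻ x in Ioc (-2 : ℝ) 2, G (tri (x + c)) = 2 * ∫⁻ y, G y ∂volI := by
  have hm : Measurable fun x => G (tri x) := hG.comp continuous_tri.measurable
  have hp : Function.Periodic (fun x => G (tri x)) 4 := fun x => by simp only [tri_periodic x]
  have hpre : (fun x => x + c) ⁻¹' Ioc (-2 + c) (-2 + c + 4) = Ioc (-2 : ℝ) 2 := by
    ext x
    simp only [mem_preimage, mem_Ioc]
    constructor <;> rintro ⟨h1, h2⟩ <;> constructor <;> linarith
  have hpre2 : (fun x => 2 - x) ⁻¹' Ioo (1 : ℝ) 3 = Ioo (-1 : ℝ) 1 := by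
    ext x
    simp only [mem_preimage, mem_Ioo]
    constructor <;> rintro ⟨h1, h2⟩ <;> constructor <;> linarith
  rw [← hpre, (measurePreserving_add_right volume c).setLIntegral_comp_preimage measurableSet_Ioc
    hm, setLIntegral_period_eq hp _ (-1)]
  have h3 : Ioc (-1 : ℝ) (-1 + 4) = Ioc (-1) 1 ∪ Ioc 1 3 := by
    rw [Ioc_union_Ioc_eq_Ioc] <;> norm_num
  rw [h3, lintegral_union measurableSet_Ioc (Ioc_disjoint_Ioc_of_le le_rfl), ← volI_eq_Ioc,
    two_mul]
  congr 1
  · exact setLIntegral_congr_fun measurableSet_Ioo fun x hx => by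
      simp only [tri_of_mem_Icc (Ioo_subset_Icc_self hx)]
  · rw [setLIntegral_congr Ioo_ae_eq_Ioc.symm,
      ← (Measure.measurePreserving_sub_left volume (2 : ℝ)).setLIntegral_comp_preimage
        measurableSet_Ioo hm, hpre2]
    exact setLIntegral_congr_fun measurableSet_Ioo fun x hx => by
      simp only [tri_two_sub (Ioo_subset_Icc_self hx)]

theorem lintegral_lintegral_comp_tri {Φ : ℝ × ℝ → ℝ≥0∞} (hΦ : Measurable Φ) :
    ∫⁻ h in Ioc (-2 : ℝ) 2, ∫⁻ x in Ioc (-2 : ℝ) 2, Φ (tri x, tri (x + h)) =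
      4 * ∫⁻ z, Φ z ∂(volI.prod volI) := by
  have ht := continuous_tri.measurable
  rw [lintegral_lintegral_swap (by fun_prop), lintegral_prod _ hΦ.aemeasurable]
  have h1 : ∀ x, ∫⁻ h in Ioc (-2 : ℝ) 2, Φ (tri x, tri (x + h)) =
      2 * ∫⁻ y, Φ (tri x, y) ∂volI := fun x => by
    simp only [add_comm x]
    exact lintegral_comp_tri (G := fun y => Φ (tri x, y)) (by fun_prop) x
  simp only [h1]
  rw [lintegral_const_mul' _ _ (by simp)]
  have h2 := lintegral_comp_tri (G := fun x => ∫⁻ y, Φ (x, y) ∂volI) hΦ.lintegral_prod_right' 0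
  simp only [add_zero] at h2
  rw [h2, ← mul_assoc]
  norm_num

/-- Differences of points of `(-1,1)` lie in `(-2,2)`: integrals over the square are bounded by
integrals over position and increment. -/
theorem lintegral_square_le {Φ : ℝ × ℝ → ℝ≥0∞} (hΦ : Measurable Φ) :
    ∫⁻ z, Φ z ∂(volI.prod volI) ≤
      ∫⁻ h in Ioc (-2 : ℝ) 2, ∫⁻ x in Ioc (-2 : ℝ) 2, Φ (x, x + h) := by
  rw [lintegral_lintegral_swap (by fun_prop), lintegral_prod _ hΦ.aemeasurable]
  refine le_trans (lintegral_mono_ae ?_) (lintegral_mono_set (Ioo_subset_Ioc_self.trans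
    (Ioc_subset_Ioc (by norm_num) (by norm_num))))
  filter_upwards [ae_restrict_mem measurableSet_Ioo] with x hx
  rw [← lintegral_indicator measurableSet_Ioo, ← lintegral_indicator measurableSet_Ioc,
    ← lintegral_add_left_eq_self _ x]
  refine lintegral_mono fun h => ?_
  by_cases hh : x + h ∈ Ioo (-1 : ℝ) 1
  · have hh' : h ∈ Ioc (-2 : ℝ) 2 := ⟨by linarith [hx.2, hh.1], by linarith [hx.1, hh.2]⟩
    rw [indicator_of_mem hh, indicator_of_mem hh']
  · rw [indicator_of_notMem hh]
    exact zero_le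

/-! ### The weight attached to a frequency -/

/-- `∫ |e_n(h) - 1|² / h² dh` over a period, which is comparable to `|n|`. -/
def freqWeight (n : ℤ) : ℝ≥0∞ := ∫⁻ h in Ioc (-2 : ℝ) 2, ‖(fexp n h - 1) / h‖ₑ ^ 2

theorem norm_fexp_sub_one (n : ℤ) (h : ℝ) :
    ‖fexp n h - 1‖ = 2 * |Real.sin (Real.pi * n * h / 4)| := by
  rw [fexp, mul_comm, Complex.norm_exp_I_mul_ofReal_sub_one, norm_mul, Real.norm_eq_abs,
    Real.norm_eq_abs, abs_two]
  congr 3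
  ring

theorem le_freqWeight (n : ℤ) : ENNReal.ofReal |(n : ℝ)| ≤ freqWeight n := by
  obtain rfl | hn := eq_or_ne n 0
  · simp
  have hn1 : (1 : ℝ) ≤ |(n : ℝ)| := by exact_mod_cast Int.one_le_abs hn
  have hn0 : (0 : ℝ) < |(n : ℝ)| := by linarith
  have hsub : Ioc (0 : ℝ) (1 / |(n : ℝ)|) ⊆ Ioc (-2 : ℝ) 2 := by
    refine Ioc_subset_Ioc (by norm_num) ?_
    rw [div_le_iff₀ hn0]
    linarith
  refine le_trans ?_ (lintegral_mono_set hsub)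
  have hle : ∀ h ∈ Ioc (0 : ℝ) (1 / |(n : ℝ)|), ENNReal.ofReal (|(n : ℝ)| ^ 2) ≤
      ‖(fexp n h - 1) / h‖ₑ ^ 2 := fun h hh => by
    rw [← ofReal_norm, ← ENNReal.ofReal_pow (norm_nonneg _)]
    refine ENNReal.ofReal_le_ofReal (pow_le_pow_left₀ hn0.le ?_ 2)
    rw [norm_div, norm_fexp_sub_one, Complex.norm_real, Real.norm_eq_abs, le_div_iff₀ (abs_pos.2 hh.1.ne')]
    have h1 : |Real.pi * n * h / 4| = Real.pi / 4 * (|(n : ℝ)| * |h|) := by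
      rw [abs_div, abs_mul, abs_mul, abs_of_pos Real.pi_pos, abs_of_pos (by norm_num : (0 : ℝ) < 4)]
      ring
    have h2 : |(n : ℝ)| * |h| ≤ 1 := by
      rw [abs_of_pos hh.1, mul_comm]
      exact (le_div_iff₀ hn0).1 hh.2
    have h3 : |Real.pi * n * h / 4| ≤ Real.pi / 2 := by
      rw [h1]
      nlinarith [Real.pi_pos]
    have h4 := Real.mul_abs_le_abs_sin h3
    rw [h1] at h4
    have h5 : 2 / Real.pi * (Real.pi / 4 * (|(n : ℝ)| * |h|)) = |(n : ℝ)| * |h| / 2 := by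
      field_simp
      norm_num
    linarith
  refine le_trans (le_of_eq ?_) (setLIntegral_mono' measurableSet_Ioc hle)
  rw [setLIntegral_const, Real.volume_Ioc, ← ENNReal.ofReal_mul (by positivity)]
  congr 1
  field_simp
  ring

theorem freqWeight_le (n : ℤ) : freqWeight n ≤ ENNReal.ofReal (8 * Real.pi * |(n : ℝ)|) := by
  obtain rfl | hn := eq_or_ne n 0
  · simp [freqWeight]
  have hn' : (n : ℝ) ≠ 0 := by exact_mod_cast hn
  have hle : ∀ h : ℝ, ‖(fexp n h - 1) / h‖ₑ ^ 2 ≤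
      ENNReal.ofReal (8 * n ^ 2 * (1 + (n * h) ^ 2)⁻¹) := fun h => by
    rw [← ofReal_norm, ← ENNReal.ofReal_pow (norm_nonneg _)]
    refine ENNReal.ofReal_le_ofReal ?_
    obtain rfl | hh := eq_or_ne h 0
    · simp
      positivity
    rw [norm_div, norm_fexp_sub_one, Complex.norm_real, Real.norm_eq_abs, div_pow, mul_pow, sq_abs,
      sq_abs, ← div_eq_mul_inv, div_le_div_iff₀ (by positivity) (by positivity)]
    have h1 : Real.sin (Real.pi * n * h / 4) ^ 2 ≤ 1 := Real.sin_sq_le_one _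
    have h2 : Real.sin (Real.pi * n * h / 4) ^ 2 ≤ (n * h) ^ 2 := by
      refine (sq_le_sq.2 Real.abs_sin_le_abs).trans ?_
      have h3 : (Real.pi * n * h / 4) ^ 2 = (Real.pi / 4) ^ 2 * (n * h) ^ 2 := by ring
      rw [h3]
      have h4 : (Real.pi / 4) ^ 2 ≤ 1 := by
        have := Real.pi_le_four
        have := Real.pi_pos
        rw [sq_le_one_iff₀ (by positivity)]
        linarith
      nlinarith [sq_nonneg (n * h)]
    nlinarith [sq_nonneg (n * h), mul_le_mul_of_nonneg_right h1 (sq_nonneg (n * h))]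
  have hint : Integrable fun h : ℝ => 8 * (n : ℝ) ^ 2 * (1 + (n * h) ^ 2)⁻¹ :=
    (integrable_inv_one_add_sq.comp_mul_left' hn').const_mul _
  calc freqWeight n ≤ ∫⁻ h in Ioc (-2 : ℝ) 2, ENNReal.ofReal (8 * n ^ 2 * (1 + (n * h) ^ 2)⁻¹) :=
        lintegral_mono hle
    _ ≤ ∫⁻ h : ℝ, ENNReal.ofReal (8 * n ^ 2 * (1 + (n * h) ^ 2)⁻¹) := setLIntegral_le_lintegral _ _
    _ = ENNReal.ofReal (∫ h : ℝ, 8 * n ^ 2 * (1 + (n * h) ^ 2)⁻¹) :=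
        (ofReal_integral_eq_lintegral_ofReal hint (ae_of_all _ fun h => by positivity)).symm
    _ = _ := by
        rw [integral_const_mul, Measure.integral_comp_mul_left (fun x : ℝ => (1 + x ^ 2)⁻¹) n,
          integral_univ_inv_one_add_sq, smul_eq_mul, abs_inv, ← sq_abs (n : ℝ)]
        congr 1
        have : |(n : ℝ)| ≠ 0 := abs_ne_zero.2 hn'
        field_simp

/-! ### Trigonometric series in `H^{1/2}(-1,1)` -/

theorem HHalf.toFun_add (v w : HHalf) :
    HHalf.toFun (v + w) =ᵐ[volI] HHalf.toFun v + HHalf.toFun w :=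
  Lp.coeFn_add v.1.fst w.1.fst

theorem HHalf.toFun_smul (c : ℝ) (v : HHalf) :
    HHalf.toFun (c • v) =ᵐ[volI] c • HHalf.toFun v :=
  Lp.coeFn_smul c v.1.fst

theorem contDiff_re_mul_fexp (n : ℤ) (z : ℂ) : ContDiff ℝ 1 fun x => (z * fexp n x).re :=
  Complex.reCLM.contDiff.comp (contDiff_const.mul (contDiff_fexp n))

/-- The function `x ↦ Re (z exp (i π n x / 2))` in `H^{1/2}(-1,1)`. -/
def mode (n : ℤ) : ℂ →ₗ[ℝ] HHalf where
  toFun z := HHalf.ofContDiff _ (contDiff_re_mul_fexp n z)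
  map_add' z w := HHalf.ext_ae <| by
    filter_upwards [HHalf.toFun_ofContDiff _ (contDiff_re_mul_fexp n (z + w)),
      HHalf.toFun_ofContDiff _ (contDiff_re_mul_fexp n z),
      HHalf.toFun_ofContDiff _ (contDiff_re_mul_fexp n w),
      HHalf.toFun_add (HHalf.ofContDiff _ (contDiff_re_mul_fexp n z))
        (HHalf.ofContDiff _ (contDiff_re_mul_fexp n w))] with x h1 h2 h3 h4
    rw [h1, h4, Pi.add_apply, h2, h3, add_mul, Complex.add_re]
  map_smul' c z := HHalf.ext_ae <| by
    filter_upwards [HHalf.toFun_ofContDiff _ (contDiff_re_mul_fexp n (c • z)),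
      HHalf.toFun_ofContDiff _ (contDiff_re_mul_fexp n z),
      HHalf.toFun_smul c (HHalf.ofContDiff _ (contDiff_re_mul_fexp n z))] with x h1 h2 h3
    rw [RingHom.id_apply, h1, h3, Pi.smul_apply, h2, smul_mul_assoc, Complex.smul_re]

theorem toFun_mode (n : ℤ) (z : ℂ) :
    HHalf.toFun (mode n z) =ᵐ[volI] fun x => (z * fexp n x).re :=
  HHalf.toFun_ofContDiff _ (contDiff_re_mul_fexp n z)

theorem toFun_sum_mode (s : Finset ℤ) (z : ℤ → ℂ) :
    HHalf.toFun (∑ n ∈ s, mode n (z n)) =ᵐ[volI] fun x => (∑ n ∈ s, z n * fexp n x).re := by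
  induction s using Finset.induction_on with
  | empty =>
    simp only [Finset.sum_empty, Complex.zero_re]
    exact Lp.coeFn_zero ℝ 2 volI
  | insert a s ha ih =>
    simp only [Finset.sum_insert ha]
    filter_upwards [HHalf.toFun_add (mode a (z a)) (∑ n ∈ s, mode n (z n)), toFun_mode a (z a),
      ih] with x h1 h2 h3
    rw [h1, Pi.add_apply, h2, h3, Complex.add_re]

theorem lintegral_trigSum_quotient (s : Finset ℤ) (z : ℤ → ℂ) :
    ∫⁻ p, ‖((∑ n ∈ s, z n * fexp n p.1) - ∑ n ∈ s, z n * fexp n p.2) / ((p.1 - p.2 : ℝ) : ℂ)‖ₑ ^ 2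
      ∂(volI.prod volI) ≤ 4 * ∑ n ∈ s, ‖z n‖ₑ ^ 2 * freqWeight n := by
  refine (lintegral_square_le ?_).trans (le_of_eq ?_)
  · have : ∀ n, Measurable (fexp n) := fun n => (continuous_fexp n).measurable
    fun_prop
  · have h1 : ∀ h x : ℝ, ‖((∑ n ∈ s, z n * fexp n x) - ∑ n ∈ s, z n * fexp n (x + h)) /
        ((x - (x + h) : ℝ) : ℂ)‖ₑ = ‖∑ n ∈ s, (z n * ((fexp n h - 1) / h)) * fexp n x‖ₑ := by
      intro h x
      congr 1
      rw [← Finset.sum_sub_distrib, Finset.sum_div, sub_add_cancel_left, Complex.ofReal_neg]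
      refine Finset.sum_congr rfl fun n _ => ?_
      rw [fexp_add, div_neg, ← neg_div]
      ring
    simp only [h1, lintegral_trigSum]
    have hm : ∀ n, Measurable (fexp n) := fun n => (continuous_fexp n).measurable
    rw [lintegral_const_mul' _ _ (by simp), lintegral_finsetSum _ (fun n _ => by fun_prop)]
    congr 1
    refine Finset.sum_congr rfl fun n _ => ?_
    simp only [enorm_mul, mul_pow]
    rw [lintegral_const_mul' _ _ (by simp), freqWeight]

/-- Trigonometric sums are bounded in `H^{1/2}(-1,1)` by the weighted norm of their
coefficients. -/
theorem norm_sq_sum_mode_le (s : Finset ℤ) (z : ℤ → ℂ) :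
    ‖∑ n ∈ s, mode n (z n)‖ ^ 2 ≤
      32 * Real.pi * ∑ n ∈ s, (1 + |(n : ℝ)|) * ‖z n‖ ^ 2 := by
  set v := ∑ n ∈ s, mode n (z n)
  have hv : HHalf.toFun v =ᵐ[volI] fun x => (∑ n ∈ s, z n * fexp n x).re := toFun_sum_mode s z
  have hre : ∀ w : ℂ, ‖w.re‖ₑ ≤ ‖w‖ₑ := fun w => by
    rw [enorm_le_iff_norm_le]
    exact Complex.abs_re_le_norm w
  have h1 : ∫⁻ x, ‖HHalf.toFun v x‖ₑ ^ 2 ∂volI ≤ 4 * ∑ n ∈ s, ‖z n‖ₑ ^ 2 := by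
    rw [← lintegral_trigSum]
    refine le_trans ?_ (lintegral_mono_set (Ioo_subset_Ioc_self.trans
      (Ioc_subset_Ioc (by norm_num : (-2 : ℝ) ≤ -1) (by norm_num : (1 : ℝ) ≤ 2))))
    refine lintegral_mono_ae ?_
    filter_upwards [hv] with x hx
    rw [hx]
    gcongr
    exact hre _
  have h2 : ∫⁻ p, ‖(HHalf.toFun v p.1 - HHalf.toFun v p.2) / (p.1 - p.2)‖ₑ ^ 2 ∂(volI.prod volI) ≤
      4 * ∑ n ∈ s, ‖z n‖ₑ ^ 2 * freqWeight n := by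
    refine le_trans (lintegral_mono_ae ?_) (lintegral_trigSum_quotient s z)
    have hv1 := (Measure.quasiMeasurePreserving_fst (μ := volI) (ν := volI)).ae_eq_comp hv
    have hv2 := (Measure.quasiMeasurePreserving_snd (μ := volI) (ν := volI)).ae_eq_comp hv
    filter_upwards [hv1, hv2] with p hp1 hp2
    simp only [Function.comp_apply] at hp1 hp2
    rw [hp1, hp2, ← Complex.sub_re, ← Complex.div_ofReal_re]
    gcongr
    exact hre _
  have hsum : 0 ≤ ∑ n ∈ s, (1 + |(n : ℝ)|) * ‖z n‖ ^ 2 :=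
    Finset.sum_nonneg fun _ _ => by positivity
  rw [← ENNReal.ofReal_le_ofReal_iff (by positivity), HHalf.ofReal_norm_sq]
  refine (add_le_add h1 h2).trans ?_
  rw [Finset.mul_sum, Finset.mul_sum, ← Finset.sum_add_distrib, Finset.mul_sum,
    ENNReal.ofReal_sum_of_nonneg fun _ _ => by positivity]
  refine Finset.sum_le_sum fun n _ => ?_
  have h3 : ‖z n‖ₑ ^ 2 = ENNReal.ofReal (‖z n‖ ^ 2) := by
    rw [ENNReal.ofReal_pow (norm_nonneg _), ofReal_norm]
  have h4 : (4 : ℝ≥0∞) = ENNReal.ofReal 4 := by simp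
  refine (add_le_add le_rfl (mul_le_mul_right (mul_le_mul_right (freqWeight_le n) _) _)).trans ?_
  rw [h3, h4, ← ENNReal.ofReal_mul (by positivity), ← ENNReal.ofReal_mul (by positivity),
    ← ENNReal.ofReal_mul (by positivity), ← ENNReal.ofReal_add (by positivity) (by positivity)]
  refine ENNReal.ofReal_le_ofReal ?_
  have h5 := Real.pi_gt_three
  have h6 : 0 ≤ ‖z n‖ ^ 2 := sq_nonneg _
  nlinarith

/-! ### Fourier coefficients of the reflected function -/

/-- The even reflection of `v` to a function of period `4`. -/
def reflect (v : HHalf) (x : ℝ) : ℂ := HHalf.toFun v (tri x)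

theorem reflect_periodic (v : HHalf) : Function.Periodic (reflect v) 4 := fun x => by
  rw [reflect, tri_periodic, reflect]

theorem measurable_toFun (v : HHalf) : Measurable (HHalf.toFun v) :=
  (Lp.stronglyMeasurable v.1.fst).measurable

theorem measurable_reflect (v : HHalf) : Measurable (reflect v) :=
  Complex.measurable_ofReal.comp ((measurable_toFun v).comp continuous_tri.measurable)

theorem lintegral_reflect (v : HHalf) (h : ℝ) :
    ∫⁻ x in Ioc (-2 : ℝ) 2, ‖reflect v (x + h)‖ₑ ^ 2 = 2 * ∫⁻ x, ‖HHalf.toFun v x‖ₑ ^ 2 ∂volI := by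
  have hm := measurable_toFun v
  rw [← lintegral_comp_tri (G := fun y => ‖HHalf.toFun v y‖ₑ ^ 2) (by fun_prop)]
  refine lintegral_congr fun x => ?_
  rw [reflect, ← ofReal_norm, ← ofReal_norm, Complex.norm_real]

theorem memLp_reflect (v : HHalf) (h : ℝ) :
    MemLp (fun x => reflect v (x + h)) 2 (volume.restrict (Ioc (-2 : ℝ) 2)) := by
  have hm := measurable_reflect v
  refine ⟨(hm.comp (measurable_add_const h)).aestronglyMeasurable, ?_⟩
  rw [eLpNorm_lt_top_iff_lintegral_rpow_enorm_lt_top (by simp) (by simp)]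
  simp only [ENNReal.toReal_ofNat, ENNReal.rpow_ofNat]
  rw [lintegral_reflect]
  have h1 := HHalf.ofReal_norm_sq v
  refine ENNReal.mul_lt_top (by simp) (lt_of_le_of_lt le_self_add (h1 ▸ ENNReal.ofReal_lt_top))

theorem fcoeff_reflect_quotient (v : HHalf) (h : ℝ) (n : ℤ) :
    fcoeff (fun x => (reflect v (x + h) - reflect v x) / h) n =
      (fexp n h - 1) / h * fcoeff (reflect v) n := by
  have hi : ∀ c, IntervalIntegrable (fun x => fexp (-n) x * reflect v (x + c)) volume (-2) 2 :=
    fun c => by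
      refine IntervalIntegrable.continuousOn_mul ?_ (continuous_fexp _).continuousOn
      rw [intervalIntegrable_iff_integrableOn_Ioc_of_le (by norm_num)]
      exact (memLp_reflect v c).integrable (by norm_num)
  have h0 := hi 0
  simp only [add_zero] at h0
  have h1 := fcoeff_shift (reflect_periodic v) h n
  have h2 : fcoeff (fun x => (reflect v (x + h) - reflect v x) / h) n =
      (fcoeff (fun x => reflect v (x + h)) n - fcoeff (reflect v) n) / h := by
    simp only [fcoeff, mul_div_assoc', mul_sub]
    rw [intervalIntegral.integral_div, intervalIntegral.integral_sub (hi h) h0]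
    ring
  rw [h2, h1]
  ring

/-- The Fourier coefficients of the even reflection of `v ∈ H^{1/2}(-1,1)` are square summable with
weight `1 + |n|`. -/
theorem summable_weighted_fcoeff_reflect (v : HHalf) :
    Summable fun n : ℤ => (1 + |(n : ℝ)|) * ‖fcoeff (reflect v) n‖ ^ 2 := by
  refine summable_of_sum_le (c := ‖v‖ ^ 2) (fun n => by positivity) fun s => ?_
  have hmv := measurable_toFun v
  have hmr := measurable_reflect v
  set a := fcoeff (reflect v)
  have h1 : 4 * ∑ n ∈ s, ‖a n‖ₑ ^ 2 ≤ 4 * ∫⁻ x, ‖HHalf.toFun v x‖ₑ ^ 2 ∂volI := by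
    have h := memLp_reflect v 0
    have h' := lintegral_reflect v 0
    simp only [add_zero] at h h'
    refine (sum_sq_fcoeff_le h s).trans ?_
    rw [h']
    gcongr
    norm_num
  set Φ : ℝ × ℝ → ℝ≥0∞ := fun p => ‖(HHalf.toFun v p.1 - HHalf.toFun v p.2) / (p.1 - p.2)‖ₑ ^ 2
  have hΦ : Measurable Φ := by fun_prop
  have hpt : ∀ h x : ℝ, ‖(reflect v (x + h) - reflect v x) / (h : ℂ)‖ₑ ^ 2 ≤
      Φ (tri x, tri (x + h)) := fun h x => by
    simp only [Φ]
    gcongr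
    rw [reflect, reflect, ← Complex.ofReal_sub, ← Complex.ofReal_div, enorm_le_iff_norm_le,
      Complex.norm_real, Real.norm_eq_abs, Real.norm_eq_abs, abs_div, abs_div,
      abs_sub_comm (HHalf.toFun v (tri x))]
    -- Where the denominator `tri x - tri (x + h)` is zero, so is the numerator on the left.
    obtain h0 | h0 := eq_or_ne (tri x) (tri (x + h))
    · simp [h0]
    · refine div_le_div_of_nonneg_left (abs_nonneg _) (abs_pos.2 (sub_ne_zero.2 h0)) ?_
      refine (abs_tri_sub_tri_le _ _).trans ?_
      simp
  have h2 : 4 * ∑ n ∈ s, ‖a n‖ₑ ^ 2 * freqWeight n ≤ 4 * ∫⁻ p, Φ p ∂(volI.prod volI) := by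
    rw [← lintegral_lintegral_comp_tri hΦ]
    have hm : ∀ n, Measurable (fexp n) := fun n => (continuous_fexp n).measurable
    have h3 : 4 * ∑ n ∈ s, ‖a n‖ₑ ^ 2 * freqWeight n = ∫⁻ h in Ioc (-2 : ℝ) 2,
        4 * ∑ n ∈ s, ‖(fexp n h - 1) / h * a n‖ₑ ^ 2 := by
      rw [lintegral_const_mul' _ _ (by simp), lintegral_finsetSum _ (fun n _ => by fun_prop)]
      congr 1
      refine Finset.sum_congr rfl fun n _ => ?_
      simp only [enorm_mul, mul_pow]
      rw [lintegral_mul_const' _ _ (by simp), freqWeight, mul_comm]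
    rw [h3]
    refine lintegral_mono fun h => ?_
    simp only [← fcoeff_reflect_quotient, a]
    have hmem : MemLp (fun x => (reflect v (x + h) - reflect v x) / (h : ℂ)) 2
        (volume.restrict (Ioc (-2 : ℝ) 2)) := by
      have h0 := memLp_reflect v 0
      simp only [add_zero] at h0
      simp only [div_eq_mul_inv]
      exact ((memLp_reflect v h).sub h0).mul_const _
    exact (sum_sq_fcoeff_le hmem s).trans (lintegral_mono fun x => hpt h x)
  rw [← ENNReal.ofReal_le_ofReal_iff (sq_nonneg _), HHalf.ofReal_norm_sq,
    ENNReal.ofReal_sum_of_nonneg fun _ _ => by positivity]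
  have h5 : ∀ n : ℤ, ENNReal.ofReal ((1 + |(n : ℝ)|) * ‖a n‖ ^ 2) ≤
      ‖a n‖ₑ ^ 2 + ‖a n‖ₑ ^ 2 * freqWeight n := fun n => by
    rw [add_mul, one_mul, ENNReal.ofReal_add (by positivity) (by positivity),
      mul_comm, ENNReal.ofReal_mul (by positivity), ENNReal.ofReal_pow (norm_nonneg _), ofReal_norm]
    gcongr
    exact le_freqWeight n
  refine (Finset.sum_le_sum fun n _ => h5 n).trans ?_
  rw [Finset.sum_add_distrib]
  have h4 : (4 : ℝ≥0∞) ≠ 0 := by simp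
  exact add_le_add ((ENNReal.mul_le_mul_iff_right h4 (by simp)).1 h1)
    ((ENNReal.mul_le_mul_iff_right h4 (by simp)).1 h2)

/-! ### Fourier coefficients of the kernels -/

theorem fexp_re (n : ℤ) (x : ℝ) : (fexp n x).re = Real.cos (Real.pi * n * x / 2) := by
  rw [fexp, Complex.exp_ofReal_mul_I_re]

theorem fexp_im (n : ℤ) (x : ℝ) : (fexp n x).im = Real.sin (Real.pi * n * x / 2) := by
  rw [fexp, Complex.exp_ofReal_mul_I_im]

theorem fcoeff_eq_half_period {f : ℝ → ℂ} (hf : IntervalIntegrable f volume (-2) 2) (n : ℤ) :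
    fcoeff f n = (1 / 4) * ∫ x in (0 : ℝ)..2, (fexp (-n) x * f x + fexp n x * f (-x)) := by
  have hg : IntervalIntegrable (fun x => fexp (-n) x * f x) volume (-2) 2 :=
    hf.continuousOn_mul (continuous_fexp _).continuousOn
  have h1 : IntervalIntegrable (fun x => fexp (-n) x * f x) volume (-2) 0 :=
    hg.mono_set (by
      rw [uIcc_of_le (by norm_num), uIcc_of_le (by norm_num)]
      exact Icc_subset_Icc (by norm_num) (by norm_num))
  have h2 : IntervalIntegrable (fun x => fexp (-n) x * f x) volume 0 2 :=
    hg.mono_set (by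
      rw [uIcc_of_le (by norm_num), uIcc_of_le (by norm_num)]
      exact Icc_subset_Icc (by norm_num) (by norm_num))
  have h3 := intervalIntegral.integral_comp_neg (a := 0) (b := 2) (fun x => fexp (-n) x * f x)
  have h4 : IntervalIntegrable (fun x => fexp (-n) (-x) * f (-x)) volume 0 2 := by
    rw [IntervalIntegrable.iff_comp_neg]
    simpa using h1.symm
  simp only [fexp_neg_arg, neg_neg, neg_zero] at h3 h4
  rw [fcoeff, ← intervalIntegral.integral_add_adjacent_intervals h1 h2,
    intervalIntegral.integral_add h2 h4, h3]
  ring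

theorem fcoeff_even {f : ℝ → ℝ} (hf : IntervalIntegrable f volume (-2) 2)
    (heven : ∀ x, f (-x) = f x) (n : ℤ) :
    fcoeff (fun x => (f x : ℂ)) n =
      ((1 / 2 * ∫ x in (0 : ℝ)..2, Real.cos (Real.pi * n * x / 2) * f x : ℝ) : ℂ) := by
  have hf' : IntervalIntegrable (fun x => (f x : ℂ)) volume (-2) 2 := ⟨hf.1.ofReal, hf.2.ofReal⟩
  rw [fcoeff_eq_half_period hf']
  have h : ∀ x : ℝ, fexp (-n) x * (f x : ℂ) + fexp n x * (f (-x) : ℂ) =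
      ((2 * (Real.cos (Real.pi * n * x / 2) * f x) : ℝ) : ℂ) := fun x => by
    rw [heven, ← conj_fexp, ← add_mul, add_comm, Complex.add_conj, fexp_re]
    push_cast
    ring
  simp only [h]
  rw [intervalIntegral.integral_ofReal, intervalIntegral.integral_const_mul]
  push_cast
  ring

theorem fcoeff_odd {f : ℝ → ℝ} (hf : IntervalIntegrable f volume (-2) 2)
    (hodd : ∀ x, f (-x) = -f x) (n : ℤ) :
    fcoeff (fun x => (f x : ℂ)) n =
      ((-(1 / 2) * ∫ x in (0 : ℝ)..2, Real.sin (Real.pi * n * x / 2) * f x : ℝ) : ℂ)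
        * Complex.I := by
  have hf' : IntervalIntegrable (fun x => (f x : ℂ)) volume (-2) 2 := ⟨hf.1.ofReal, hf.2.ofReal⟩
  rw [fcoeff_eq_half_period hf']
  have h : ∀ x : ℝ, fexp (-n) x * (f x : ℂ) + fexp n x * (f (-x) : ℂ) =
      ((-2 * (Real.sin (Real.pi * n * x / 2) * f x) : ℝ) : ℂ) * Complex.I := fun x => by
    have h1 : fexp (-n) x * (f x : ℂ) + fexp n x * (f (-x) : ℂ) =
        -((fexp n x - (starRingEnd ℂ) (fexp n x)) * f x) := by
      rw [hodd, conj_fexp]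
      push_cast
      ring
    rw [h1, Complex.sub_conj, fexp_im]
    push_cast
    ring
  simp only [h]
  rw [intervalIntegral.integral_mul_const, intervalIntegral.integral_ofReal,
    intervalIntegral.integral_const_mul]
  push_cast
  ring

theorem intervalIntegrable_log_sq : IntervalIntegrable (fun x => Real.log x ^ 2) volume (-2) 2 := by
  have h0 : IntervalIntegrable (fun x => Real.log x ^ 2) volume 0 2 := by
    have hd : IntervalIntegrable (fun x : ℝ => 32 * (x ^ (1 / 2 : ℝ) + x ^ (-(1 / 2) : ℝ)))
        volume 0 2 :=
      ((intervalIntegral.intervalIntegrable_rpow' (by norm_num)).add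
        (intervalIntegral.intervalIntegrable_rpow' (by norm_num))).const_mul _
    refine hd.mono_fun (Real.measurable_log.pow_const 2).aestronglyMeasurable ?_
    rw [uIoc_of_le (by norm_num)]
    filter_upwards [ae_restrict_mem measurableSet_Ioc] with x hx
    have hx0 : 0 < x := hx.1
    -- `x ^ (-1/4)` dominates `log` at `0`, and its square is still integrable.
    have h1 := Real.log_le_rpow_div hx0.le (ε := 1 / 4) (by norm_num)
    have h2 := Real.log_le_rpow_div (inv_pos.2 hx0).le (ε := 1 / 4) (by norm_num)
    rw [Real.log_inv, Real.inv_rpow hx0.le, ← Real.rpow_neg hx0.le] at h2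
    have h3 : 0 < x ^ (1 / 4 : ℝ) := Real.rpow_pos_of_pos hx0 _
    have h4 : 0 < x ^ (-(1 / 4) : ℝ) := Real.rpow_pos_of_pos hx0 _
    have h5 : x ^ (1 / 2 : ℝ) = (x ^ (1 / 4 : ℝ)) ^ 2 := by
      rw [← Real.rpow_natCast, ← Real.rpow_mul hx0.le]; norm_num
    have h6 : x ^ (-(1 / 2) : ℝ) = (x ^ (-(1 / 4) : ℝ)) ^ 2 := by
      rw [← Real.rpow_natCast, ← Real.rpow_mul hx0.le]; norm_num
    rw [h5, h6, Real.norm_of_nonneg (sq_nonneg _), Real.norm_of_nonneg (by positivity)]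
    set a := x ^ (1 / 4 : ℝ)
    set b := x ^ (-(1 / 4) : ℝ)
    have h7 : |Real.log x| ≤ 4 * (a + b) := abs_le.2 ⟨by linarith, by linarith⟩
    have h8 := pow_le_pow_left₀ (abs_nonneg _) h7 2
    rw [sq_abs] at h8
    nlinarith [sq_nonneg (a - b)]
  refine IntervalIntegrable.trans (b := 0) ?_ h0
  rw [IntervalIntegrable.iff_comp_neg]
  simpa using h0.symm

theorem measurable_logKernel : Measurable logKernel := by
  unfold logKernel
  fun_prop

theorem measurable_sgnKernel : Measurable sgnKernel := by
  unfold sgnKernel Real.sign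
  exact Measurable.ite measurableSet_Iio measurable_const
    (Measurable.ite measurableSet_Ioi measurable_const measurable_const)

theorem memLp_logKernel :
    MemLp (fun x => (logKernel x : ℂ)) 2 (volume.restrict (Ioc (-2 : ℝ) 2)) := by
  suffices h : MemLp logKernel 2 (volume.restrict (Ioc (-2 : ℝ) 2)) from h.ofReal
  rw [memLp_two_iff_integrable_sq measurable_logKernel.aestronglyMeasurable]
  have h := (intervalIntegrable_iff_integrableOn_Ioc_of_le (by norm_num)).1 intervalIntegrable_log_sq
  simpa [logKernel, IntegrableOn] using h

theorem abs_sgnKernel_le (x : ℝ) : |sgnKernel x| ≤ 1 := by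
  unfold sgnKernel
  obtain h | h | h := Real.sign_apply_eq x <;> simp [h]

theorem memLp_sgnKernel :
    MemLp (fun x => (sgnKernel x : ℂ)) 2 (volume.restrict (Ioc (-2 : ℝ) 2)) :=
  MemLp.ofReal (MemLp.of_bound measurable_sgnKernel.aestronglyMeasurable 1
    (ae_of_all _ abs_sgnKernel_le))

/-- The Fourier coefficients of `-log |x|` on `(-2,2)`. -/
def logCoeff (n : ℤ) : ℝ :=
  1 / 2 * ∫ x in (0 : ℝ)..2, Real.cos (Real.pi * n * x / 2) * -Real.log x

theorem fcoeff_logKernel (n : ℤ) : fcoeff (fun x => (logKernel x : ℂ)) n = -(logCoeff n : ℂ) := by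
  have h : IntervalIntegrable logKernel volume (-2) 2 := by
    have hlog : logKernel = Real.log := by
      ext x
      simp [logKernel]
    rw [hlog]
    exact intervalIntegral.intervalIntegrable_log'
  rw [fcoeff_even h (fun x => by simp [logKernel]), logCoeff, ← Complex.ofReal_neg]
  simp [logKernel]

/-- The Fourier coefficients of `sgn x` on `(-2,2)`, divided by `i`. -/
def sgnCoeff (n : ℤ) : ℝ := -(1 / 2) * ∫ x in (0 : ℝ)..2, Real.sin (Real.pi * n * x / 2)

theorem fcoeff_sgnKernel (n : ℤ) :
    fcoeff (fun x => (sgnKernel x : ℂ)) n = (sgnCoeff n : ℂ) * Complex.I := by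
  have h : IntervalIntegrable sgnKernel volume (-2) 2 :=
    (intervalIntegrable_const (c := (1 : ℝ))).mono_fun
      measurable_sgnKernel.aestronglyMeasurable
      (ae_of_all _ fun x => by simpa using abs_sgnKernel_le x)
  have h' : ∫ x in (0 : ℝ)..2, Real.sin (Real.pi * n * x / 2) * sgnKernel x =
      ∫ x in (0 : ℝ)..2, Real.sin (Real.pi * n * x / 2) :=
    intervalIntegral.integral_congr_Ioo_of_le (by norm_num) fun x hx => by
      simp [sgnKernel, Real.sign_of_pos hx.1]
  rw [fcoeff_odd h (fun x => by simp [sgnKernel, Real.sign_neg]), h', sgnCoeff]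

theorem abs_sgnCoeff_le (n : ℤ) : (1 + |(n : ℝ)|) * |sgnCoeff n| ≤ 2 := by
  obtain rfl | hn := eq_or_ne n 0
  · simp [sgnCoeff]
  have hn1 : (1 : ℝ) ≤ |(n : ℝ)| := by exact_mod_cast Int.one_le_abs hn
  have hn' : (n : ℝ) ≠ 0 := by exact_mod_cast hn
  set b : ℝ := Real.pi * n / 2 with hb
  have hb0 : b ≠ 0 := by simp [hb, Real.pi_ne_zero, hn']
  have h1 : ∫ x in (0 : ℝ)..2, Real.sin (Real.pi * n * x / 2) = b⁻¹ * (1 - Real.cos (b * 2)) := by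
    have : ∀ x : ℝ, Real.pi * n * x / 2 = b * x := fun x => by rw [hb]; ring
    simp only [this]
    rw [intervalIntegral.integral_comp_mul_left _ hb0, integral_sin]
    simp
  have h2 : |1 - Real.cos (b * 2)| ≤ 2 := by
    rw [abs_le]
    constructor <;> linarith [Real.neg_one_le_cos (b * 2), Real.cos_le_one (b * 2)]
  have h3 : |b| = Real.pi * |(n : ℝ)| / 2 := by
    rw [hb, abs_div, abs_mul, abs_of_pos Real.pi_pos, abs_two]
  rw [sgnCoeff, h1, abs_mul, abs_mul, abs_inv, h3]
  have h4 : |-(1 / 2 : ℝ)| = 1 / 2 := by norm_num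
  have h5 : (0 : ℝ) < Real.pi * |(n : ℝ)| := by positivity
  have h6 : (Real.pi * |(n : ℝ)| / 2)⁻¹ = 2 / (Real.pi * |(n : ℝ)|) := inv_div _ _
  rw [h4, h6]
  have h7 : (1 + |(n : ℝ)|) * (2 / (Real.pi * |(n : ℝ)|)) ≤ 2 := by
    rw [mul_div_assoc', div_le_iff₀ h5]
    nlinarith [Real.pi_gt_three]
  have h8 : 0 ≤ (1 + |(n : ℝ)|) * (2 / (Real.pi * |(n : ℝ)|)) := by positivity
  nlinarith

/-! ### The sine integral at multiples of `π` -/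

/-- `|∫ sin x / x dx|` over `(k π, (k + 1) π)`. -/
def sincBump (k : ℕ) : ℝ := ∫ x in (0 : ℝ)..Real.pi, (-1) ^ k * Real.sinc (x + k * Real.pi)

theorem sincBump_integrand {x : ℝ} (hx : x ∈ Ioo 0 Real.pi) (k : ℕ) :
    (-1) ^ k * Real.sinc (x + k * Real.pi) = Real.sin x / (x + k * Real.pi) := by
  have h : 0 < x + k * Real.pi := by have := hx.1; positivity
  rw [Real.sinc_of_ne_zero h.ne', Real.sin_add_nat_mul_pi, mul_div_assoc', ← mul_assoc,
    ← mul_pow]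
  simp

theorem continuous_sincBump_integrand (k : ℕ) :
    Continuous fun x => (-1) ^ k * Real.sinc (x + k * Real.pi) :=
  continuous_const.mul (Real.continuous_sinc.comp (by fun_prop))

theorem sincBump_nonneg (k : ℕ) : 0 ≤ sincBump k := by
  have h := intervalIntegral.integral_mono_on_of_le_Ioo Real.pi_pos.le
    (intervalIntegrable_const (μ := volume) (c := (0 : ℝ)))
    ((continuous_sincBump_integrand k).intervalIntegrable 0 Real.pi) (fun x hx => by
      rw [sincBump_integrand hx]
      have := Real.sin_pos_of_pos_of_lt_pi hx.1 hx.2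
      have := hx.1
      positivity)
  rwa [intervalIntegral.integral_zero] at h

theorem sincBump_succ_le (k : ℕ) : sincBump (k + 1) ≤ sincBump k := by
  refine intervalIntegral.integral_mono_on_of_le_Ioo Real.pi_pos.le
    ((continuous_sincBump_integrand _).intervalIntegrable 0 Real.pi)
    ((continuous_sincBump_integrand k).intervalIntegrable 0 Real.pi) fun x hx => ?_
  rw [sincBump_integrand hx, sincBump_integrand hx]
  have := Real.sin_pos_of_pos_of_lt_pi hx.1 hx.2
  have := hx.1
  gcongr
  simp

theorem sincBump_one_lt : sincBump 1 < sincBump 0 := by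
  rw [← sub_pos, sincBump, sincBump, ← intervalIntegral.integral_sub
    ((continuous_sincBump_integrand 0).intervalIntegrable 0 Real.pi)
    ((continuous_sincBump_integrand 1).intervalIntegrable 0 Real.pi)]
  refine intervalIntegral.intervalIntegral_pos_of_pos_on
    (((continuous_sincBump_integrand 0).sub (continuous_sincBump_integrand 1)).intervalIntegrable
      0 Real.pi) (fun x hx => ?_) Real.pi_pos
  rw [sincBump_integrand hx, sincBump_integrand hx, sub_pos]
  have h1 := Real.sin_pos_of_pos_of_lt_pi hx.1 hx.2
  have h2 := hx.1
  refine div_lt_div_of_pos_left h1 (by positivity) ?_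
  simp [Real.pi_pos]

theorem integral_sinc_nat_mul_pi (N : ℕ) :
    ∫ x in (0 : ℝ)..N * Real.pi, Real.sinc x = ∑ k ∈ Finset.range N, (-1) ^ k * sincBump k := by
  induction N with
  | zero => simp
  | succ N ih =>
    have hi : ∀ a b : ℝ, IntervalIntegrable Real.sinc volume a b := fun a b =>
      Real.continuous_sinc.intervalIntegrable a b
    rw [Finset.sum_range_succ, ← ih, ← intervalIntegral.integral_add_adjacent_intervals
      (hi 0 (N * Real.pi)) (hi _ _), sincBump, intervalIntegral.integral_const_mul, ← mul_assoc,
      ← mul_pow, intervalIntegral.integral_comp_add_right]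
    have h : Real.pi + N * Real.pi = ((N + 1 : ℕ) : ℝ) * Real.pi := by push_cast; ring
    rw [h]
    simp

/-- The sine integral at positive multiples of `π` is bounded and bounded away from zero, its
increments being alternating and decreasing in modulus. -/
theorem sinc_integral_bounds (N : ℕ) :
    sincBump 0 - sincBump 1 ≤ ∫ x in (0 : ℝ)..((N + 1 : ℕ) : ℝ) * Real.pi, Real.sinc x ∧
      ∫ x in (0 : ℝ)..((N + 1 : ℕ) : ℝ) * Real.pi, Real.sinc x ≤ sincBump 0 := by
  set S : ℕ → ℝ := fun N => ∑ k ∈ Finset.range N, (-1) ^ k * sincBump k with hS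
  have hodd : ∀ m, S (2 * m + 1) ≤ sincBump 0 := fun m => by
    induction m with
    | zero => simp [hS]
    | succ m ih =>
      have h : S (2 * (m + 1) + 1) = S (2 * m + 1) - sincBump (2 * m + 1) + sincBump (2 * m + 2) := by
        simp only [hS, mul_add, Finset.sum_range_succ]
        simp [pow_succ, pow_mul]
        ring
      linarith [sincBump_succ_le (2 * m + 1)]
  have heven : ∀ m, sincBump 0 - sincBump 1 ≤ S (2 * m + 2) := fun m => by
    induction m with
    | zero => simp [hS, Finset.sum_range_succ, sub_eq_add_neg]
    | succ m ih =>
      have h : S (2 * (m + 1) + 2) = S (2 * m + 2) + sincBump (2 * m + 2) - sincBump (2 * m + 3) := by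
        simp only [hS, mul_add, Finset.sum_range_succ]
        simp [pow_succ, pow_mul]
        ring
      linarith [sincBump_succ_le (2 * m + 2)]
  have hstep : ∀ m, S (2 * m + 2) = S (2 * m + 1) - sincBump (2 * m + 1) := fun m => by
    simp only [hS, Finset.sum_range_succ]
    simp [pow_succ, pow_mul]
    ring
  rw [integral_sinc_nat_mul_pi]
  change _ ≤ S (N + 1) ∧ S (N + 1) ≤ _
  obtain ⟨m, rfl | rfl⟩ := Nat.even_or_odd' N
  · have := hstep m
    exact ⟨by linarith [heven m, sincBump_nonneg (2 * m + 1)], hodd m⟩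
  · have := hstep m
    exact ⟨heven m, by linarith [hodd m, sincBump_nonneg (2 * m + 1)]⟩

theorem logCoeff_zero : logCoeff 0 = 1 - Real.log 2 := by
  simp [logCoeff, integral_log]
  ring

theorem logCoeff_natCast {N : ℕ} (hN : N ≠ 0) :
    logCoeff N = (Real.pi * N)⁻¹ * ∫ x in (0 : ℝ)..N * Real.pi, Real.sinc x := by
  have hN' : (0 : ℝ) < N := by exact_mod_cast Nat.pos_of_ne_zero hN
  set a : ℝ := Real.pi * N / 2 with ha
  have ha0 : 0 < a := by positivity
  have hsinc : Continuous fun x : ℝ => Real.sinc (a * x) :=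
    Real.continuous_sinc.comp (by fun_prop)
  have hil : IntervalIntegrable (fun x => Real.cos (a * x) * Real.log x) volume 0 2 :=
    intervalIntegral.intervalIntegrable_log'.continuousOn_mul (by fun_prop)
  have hi : IntervalIntegrable (fun x => Real.cos (a * x) * Real.log x + Real.sinc (a * x))
      volume 0 2 := hil.add (hsinc.intervalIntegrable _ _)
  -- Integration by parts: the primitive `log x * sin (a x) / a` is continuous at `0` when it is
  -- written with `sinc`, and vanishes at `2` because `2 a = N π`.
  have key := intervalIntegral.integral_eq_sub_of_hasDerivAt_of_le (by norm_num : (0 : ℝ) ≤ 2)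
    (f := fun x => x * Real.log x * Real.sinc (a * x))
    (f' := fun x => Real.cos (a * x) * Real.log x + Real.sinc (a * x))
    (Real.continuous_mul_log.mul hsinc).continuousOn (fun x hx => by
      have hx0 : 0 < x := hx.1
      have h1 : HasDerivAt (fun x => Real.log x * (Real.sin (a * x) / a))
          (x⁻¹ * (Real.sin (a * x) / a) + Real.log x * (Real.cos (a * x) * a / a)) x := by
        refine (Real.hasDerivAt_log hx0.ne').mul (HasDerivAt.div_const ?_ a)
        have := ((hasDerivAt_id x).const_mul a).sin
        simpa using this
      have h2 : x⁻¹ * (Real.sin (a * x) / a) + Real.log x * (Real.cos (a * x) * a / a) =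
          Real.cos (a * x) * Real.log x + Real.sinc (a * x) := by
        rw [Real.sinc_of_ne_zero (by positivity)]
        field_simp
        ring
      rw [← h2]
      refine h1.congr_of_eventuallyEq ?_
      filter_upwards [lt_mem_nhds hx0] with y hy
      have hy' : 0 < y := hy
      rw [Real.sinc_of_ne_zero (by positivity)]
      field_simp) hi
  have hend : Real.sinc (a * 2) = 0 := by
    rw [Real.sinc_of_ne_zero (by positivity), ha, div_mul_cancel₀ _ (by norm_num), mul_comm,
      Real.sin_nat_mul_pi, zero_div]
  rw [intervalIntegral.integral_add hil (hsinc.intervalIntegrable _ _), hend,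
    intervalIntegral.integral_comp_mul_left _ ha0.ne'] at key
  have h2a : a * 2 = N * Real.pi := by rw [ha]; ring
  rw [h2a] at key
  have harg : ∀ x : ℝ, Real.pi * ((N : ℤ) : ℝ) * x / 2 = a * x := fun x => by
    rw [ha]; push_cast; ring
  simp only [logCoeff, harg, mul_neg]
  rw [intervalIntegral.integral_neg]
  simp only [mul_zero, zero_mul, sub_zero, smul_eq_mul] at key
  have h3 : (Real.pi * N)⁻¹ = 1 / 2 * a⁻¹ := by rw [ha]; field_simp
  rw [h3]
  linarith

theorem logCoeff_neg (n : ℤ) : logCoeff (-n) = logCoeff n := by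
  simp only [logCoeff]
  congr 2
  ext x
  rw [← Real.cos_neg]
  congr 2
  push_cast
  ring

/-- The coefficients of `-log |x|` are positive and comparable to `1 / (1 + |n|)`. -/
theorem logCoeff_bounds : ∃ c > 0, ∃ C, ∀ n : ℤ,
    c ≤ (1 + |(n : ℝ)|) * logCoeff n ∧ (1 + |(n : ℝ)|) * logCoeff n ≤ C := by
  have hpi := Real.pi_pos
  have hlog : 0 < 1 - Real.log 2 := by linarith [Real.log_two_lt_d9]
  have hd : 0 < sincBump 0 - sincBump 1 := sub_pos.2 sincBump_one_lt
  refine ⟨min (1 - Real.log 2) ((sincBump 0 - sincBump 1) / Real.pi), lt_min hlog (by positivity),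
    max (1 - Real.log 2) (2 * sincBump 0 / Real.pi), fun n => ?_⟩
  obtain ⟨N, hN⟩ : ∃ N : ℕ, n = N ∨ n = -N := ⟨n.natAbs, Int.natAbs_eq n⟩
  have h1 : logCoeff n = logCoeff N := by
    obtain rfl | rfl := hN
    · rfl
    · exact logCoeff_neg _
  have h2 : |(n : ℝ)| = N := by
    obtain rfl | rfl := hN <;> simp
  rw [h1, h2]
  obtain _ | N := N
  · simp [logCoeff_zero]
  rw [logCoeff_natCast (Nat.succ_ne_zero N)]
  obtain ⟨hl, hu⟩ := sinc_integral_bounds N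
  set I := ∫ x in (0 : ℝ)..((N + 1 : ℕ) : ℝ) * Real.pi, Real.sinc x
  have hM : (1 : ℝ) ≤ ((N + 1 : ℕ) : ℝ) := by simp
  set M : ℝ := ((N + 1 : ℕ) : ℝ)
  have hM0 : 0 < M := by linarith
  have h3 : (1 + M) * ((Real.pi * M)⁻¹ * I) = (1 + M) / M * I / Real.pi := by field_simp
  have h4 : 1 ≤ (1 + M) / M := by rw [le_div_iff₀ hM0]; linarith
  have h5 : (1 + M) / M ≤ 2 := by rw [div_le_iff₀ hM0]; linarith
  rw [h3]
  refine ⟨(min_le_right _ _).trans ?_, le_trans ?_ (le_max_right _ _)⟩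
  · gcongr
    nlinarith
  · gcongr
    linarith

/-! ### Convolutions as Fourier multipliers -/

/-- A series of modes converging in `H^{1/2}(-1,1)` and pointwise has the same sum in both senses. -/
theorem toFun_eq_of_hasSum_mode {z : ℤ → ℂ} {v : HHalf} (hv : HasSum (fun n => mode n (z n)) v)
    {F : ℝ → ℂ} (hF : ∀ x ∈ Ioo (-1 : ℝ) 1, HasSum (fun n => z n * fexp n x) (F x)) :
    HHalf.toFun v =ᵐ[volI] fun x => (F x).re := by
  have hlim : Tendsto (fun s : Finset ℤ => (∑ n ∈ s, mode n (z n)).1.fst) atTop (𝓝 v.1.fst) :=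
    ((WithLp.prod_continuous_ofLp 2 _ _).fst.comp continuous_subtype_val).continuousAt.tendsto.comp
      hv
  obtain ⟨s, hs, hae⟩ := (tendstoInMeasure_of_tendsto_Lp hlim).exists_seq_tendsto_ae'
  have hsum := ae_all_iff.2 fun k => toFun_sum_mode (s k) z
  filter_upwards [hae, hsum, ae_restrict_mem measurableSet_Ioo] with x h1 h2 hx
  refine tendsto_nhds_unique h1 ?_
  have hFx : Tendsto (fun s => ∑ n ∈ s, z n * fexp n x) atTop (𝓝 (F x)) := hF x hx
  have h3 : Tendsto (fun k => (∑ n ∈ s k, z n * fexp n x).re) atTop (𝓝 (F x).re) :=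
    (Complex.continuous_re.tendsto _).comp (hFx.comp hs)
  exact h3.congr fun k => (h2 k).symm

theorem conj_fcoeff_ofReal (f : ℝ → ℝ) (n : ℤ) :
    (starRingEnd ℂ) (fcoeff (fun x => (f x : ℂ)) n) = fcoeff (fun x => (f x : ℂ)) (-n) := by
  rw [fcoeff, fcoeff, map_mul, intervalIntegral.integral_of_le (by norm_num),
    intervalIntegral.integral_of_le (by norm_num), ← integral_conj,
    map_div₀, map_one, map_ofNat]
  simp only [map_mul, conj_fexp, Complex.conj_ofReal]

theorem IsTest.eq_zero {φ : ℝ → ℝ} (hφ : IsTest φ) {x : ℝ} (hx : x ∉ Ioo (-1 : ℝ) 1) : φ x = 0 :=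
  image_eq_zero_of_notMem_tsupport fun h => hx (hφ.supp h)

theorem IsTest.fcoeff_eq_integral {φ : ℝ → ℝ} (hφ : IsTest φ) (n : ℤ) :
    fcoeff (fun x => (φ x : ℂ)) n = (1 / 4) * ∫ x, fexp (-n) x * (φ x : ℂ) := by
  rw [fcoeff, intervalIntegral.integral_eq_integral_of_support_subset]
  intro x hx
  by_contra hx'
  refine hx ?_
  change fexp (-n) x * (φ x : ℂ) = 0
  rw [hφ.eq_zero fun h => hx' ⟨by linarith [h.1], by linarith [h.2]⟩]
  simp

theorem IsTest.fcoeff_reflect_shift {φ : ℝ → ℝ} (hφ : IsTest φ) {x : ℝ} (hx : x ∈ Ioo (-1 : ℝ) 1)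
    (n : ℤ) : fcoeff (fun y => (φ (x - y) : ℂ)) n =
      fexp (-n) x * fcoeff (fun y => (φ y : ℂ)) (-n) := by
  rw [hφ.fcoeff_eq_integral, fcoeff, intervalIntegral.integral_eq_integral_of_support_subset,
    ← integral_sub_left_eq_self _ _ x, mul_left_comm, ← integral_const_mul]
  · have h : ∀ y, fexp (-n) (x - y) * (φ (x - (x - y)) : ℂ) =
        fexp (-n) x * (fexp (- -n) y * (φ y : ℂ)) := fun y => by
      rw [sub_sub_cancel, sub_eq_add_neg, fexp_add, fexp_neg_arg, mul_assoc]
    simp only [h, integral_const_mul]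
  · intro y hy
    by_contra hy'
    refine hy ?_
    change fexp (-n) y * (φ (x - y) : ℂ) = 0
    rw [hφ.eq_zero fun h => hy' ⟨by linarith [h.2, hx.1], by linarith [h.1, hx.2]⟩]
    simp

/-- Since points of `(-1,1)` differ by less than `2`, only the values of a kernel on one period
`(-2,2)` matter, and Parseval's identity expands the convolution in exponentials. -/
theorem hasSum_convolution {K φ : ℝ → ℝ}
    (hK : MemLp (fun x => (K x : ℂ)) 2 (volume.restrict (Ioc (-2 : ℝ) 2))) (hφ : IsTest φ) {x : ℝ}
    (hx : x ∈ Ioo (-1 : ℝ) 1) :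
    HasSum (fun n => 4 * fcoeff (fun y => (K y : ℂ)) n * fcoeff (fun y => (φ y : ℂ)) n * fexp n x)
      ((K ⋆[ContinuousLinearMap.mul ℝ ℝ] φ) x : ℂ) := by
  have hφc : Continuous fun y => (φ (x - y) : ℂ) :=
    Complex.continuous_ofReal.comp (hφ.smooth.continuous.comp (by fun_prop))
  have h := (hasSum_conj_fcoeff_mul_fcoeff hK (memLp_period_of_continuous hφc)).mul_left 4
  rw [← (Equiv.neg ℤ).hasSum_iff] at h
  have h1 : ∀ n, 4 * fcoeff (fun y => (K y : ℂ)) n * fcoeff (fun y => (φ y : ℂ)) n * fexp n x =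
      4 * ((starRingEnd ℂ) (fcoeff (fun y => (K y : ℂ)) (-n)) *
        fcoeff (fun y => (φ (x - y) : ℂ)) (-n)) := fun n => by
    rw [conj_fcoeff_ofReal, hφ.fcoeff_reflect_shift hx, neg_neg]
    ring
  have h2 : ((K ⋆[ContinuousLinearMap.mul ℝ ℝ] φ) x : ℂ) =
      4 * (1 / 4 * ∫ y in (-2 : ℝ)..2, (starRingEnd ℂ) (K y : ℂ) * (φ (x - y) : ℂ)) := by
    rw [convolution_def, ← mul_assoc, intervalIntegral.integral_eq_integral_of_support_subset,
      ← integral_complex_ofReal]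
    · norm_num
    · intro y hy
      by_contra hy'
      refine hy ?_
      change (starRingEnd ℂ) (K y : ℂ) * (φ (x - y) : ℂ) = 0
      rw [hφ.eq_zero fun h => hy' ⟨by linarith [h.2, hx.1], by linarith [h.1, hx.2]⟩]
      simp
  simp only [h1]
  rw [h2]
  exact h

theorem ofContDiff_conv_eq {K φ : ℝ → ℝ} (hKl : LocallyIntegrable K)
    (hK : MemLp (fun x => (K x : ℂ)) 2 (volume.restrict (Ioc (-2 : ℝ) 2))) (hφ : IsTest φ)
    {v : HHalf} (hv : HasSum (fun n => mode n
      (4 * fcoeff (fun y => (K y : ℂ)) n * fcoeff (fun y => (φ y : ℂ)) n)) v) :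
    HHalf.ofContDiff (K ⋆[ContinuousLinearMap.mul ℝ ℝ] φ) (contDiff_conv hKl hφ) = v := by
  refine HHalf.ext_ae ?_
  filter_upwards [HHalf.toFun_ofContDiff _ (contDiff_conv hKl hφ),
    toFun_eq_of_hasSum_mode hv fun x hx => hasSum_convolution hK hφ hx] with x h1 h2
  rw [h1, h2, Complex.ofReal_re]

theorem pairing_mode {φ : ℝ → ℝ} (hφ : IsTest φ) (n : ℤ) (z : ℂ) :
    pairing hφ.memLp (mode n z) = 4 * ⟪fcoeff (fun x => (φ x : ℂ)) n, z⟫ := by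
  rw [pairing_apply, Complex.inner, conj_fcoeff_ofReal, hφ.fcoeff_eq_integral, neg_neg]
  have h1 : ∫ x, HHalf.toFun (mode n z) x * φ x ∂volI = ∫ x, (z * fexp n x).re * φ x ∂volI := by
    refine integral_congr_ae ?_
    filter_upwards [toFun_mode n z] with x hx
    rw [hx]
  have h2 : Integrable (fun x => z * fexp n x * (φ x : ℂ)) := by
    refine Continuous.integrable_of_hasCompactSupport ?_ ?_
    · have := hφ.smooth.continuous
      fun_prop
    · refine HasCompactSupport.mul_left ?_
      exact hφ.compact.comp_left (g := fun y : ℝ => (y : ℂ)) Complex.ofReal_zero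
  rw [h1, setIntegral_eq_integral_of_forall_compl_eq_zero fun x hx => by
    rw [hφ.eq_zero hx, mul_zero]]
  have h3 : ∀ x, (z * fexp n x).re * φ x = (z * fexp n x * (φ x : ℂ)).re := fun x => by simp
  simp only [h3]
  have h4 := integral_re h2
  simp only [RCLike.re_eq_complex_re] at h4
  rw [h4]
  simp only [mul_assoc]
  rw [integral_const_mul]
  have h5 : z * ((1 / 4 : ℂ) * ∫ x, fexp n x * (φ x : ℂ)) =
      ((1 / 4 : ℝ) : ℂ) * (z * ∫ x, fexp n x * (φ x : ℂ)) := by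
    push_cast
    ring
  rw [h5, Complex.re_ofReal_mul]
  ring

theorem logCoeff_pos (n : ℤ) : 0 < logCoeff n := by
  obtain ⟨c, hc, C, hL⟩ := logCoeff_bounds
  exact (mul_pos_iff_of_pos_left (by positivity)).1 (hc.trans_le (hL n).1)

/-- `H^{1/2}(-1,1)` as the image of `ℓ²` under `ψ ↦ ∑ √Lₙ ψₙ eₙ`, where the `Lₙ` are the Fourier
coefficients of `-log |x|`.  Surjectivity is obtained from the even reflection. -/
theorem exists_log_synthesis : ∃ E : lp (fun _ : ℤ => ℂ) 2 →L[ℝ] HHalf, Function.Surjective E ∧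
    ∀ ψ, HasSum (fun n => mode n (√(logCoeff n) • ψ n)) (E ψ) := by
  obtain ⟨c, hc, C, hL⟩ := logCoeff_bounds
  obtain ⟨E, hE⟩ := exists_synthesis (fun n => √(logCoeff n) • mode n) (C := 32 * Real.pi * C)
    fun s z => by
      have h := norm_sq_sum_mode_le s fun n => √(logCoeff n) • z n
      simp only [LinearMap.smul_apply, ← map_smul]
      refine h.trans ?_
      rw [mul_assoc (32 * Real.pi), Finset.mul_sum s _ C]
      refine mul_le_mul_of_nonneg_left (Finset.sum_le_sum fun n _ => ?_) (by positivity)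
      rw [norm_smul, mul_pow, Real.norm_eq_abs, sq_abs, Real.sq_sqrt (logCoeff_pos n).le, ← mul_assoc]
      exact mul_le_mul_of_nonneg_right (hL n).2 (sq_nonneg _)
  simp only [LinearMap.smul_apply, ← map_smul] at hE
  refine ⟨E, fun v => ?_, hE⟩
  set a := fcoeff (reflect v)
  have hmem : Memℓp (fun n => (√(logCoeff n))⁻¹ • a n) 2 := by
    refine memℓp_gen ?_
    refine Summable.of_nonneg_of_le (fun _ => by positivity) (fun n => ?_)
      ((summable_weighted_fcoeff_reflect v).mul_left c⁻¹)
    simp only [ENNReal.toReal_ofNat, Real.rpow_ofNat]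
    rw [norm_smul, mul_pow, norm_inv, inv_pow, Real.norm_eq_abs, sq_abs, Real.sq_sqrt (logCoeff_pos n).le,
      ← mul_assoc]
    refine mul_le_mul_of_nonneg_right ?_ (sq_nonneg _)
    rw [inv_mul_eq_div, le_div_iff₀ hc, inv_mul_le_iff₀ (logCoeff_pos n), mul_comm]
    exact (hL n).1
  set ψ : lp (fun _ : ℤ => ℂ) 2 := ⟨_, hmem⟩
  have hψ : ∀ n, √(logCoeff n) • ψ n = a n := fun n =>
    smul_inv_smul₀ (Real.sqrt_pos.2 (logCoeff_pos n)).ne' (a n)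
  have hsum := hE ψ
  simp only [hψ] at hsum
  refine ⟨ψ, ?_⟩
  refine HHalf.ext_test fun φ hφ => ?_
  rw [← pairing_apply hφ.memLp, ← pairing_apply hφ.memLp]
  have h1 := (pairing hφ.memLp).hasSum hsum
  simp only [pairing_mode hφ] at h1
  refine h1.unique ?_
  have hφc : Continuous fun y => (φ y : ℂ) :=
    Complex.continuous_ofReal.comp hφ.smooth.continuous
  have h0 := memLp_reflect v 0
  simp only [add_zero] at h0
  have h2 := (hasSum_conj_fcoeff_mul_fcoeff (memLp_period_of_continuous hφc) h0).mul_left 4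
  have h3 := Complex.reCLM.hasSum h2
  have h4 : ∀ x, (starRingEnd ℂ) (φ x : ℂ) * reflect v x =
      ((HHalf.toFun v (tri x) * φ x : ℝ) : ℂ) := fun x => by
    rw [Complex.conj_ofReal, reflect]
    push_cast
    ring
  have h5 : ∫ x in Ioc (-2 : ℝ) 2, HHalf.toFun v (tri x) * φ x =
      ∫ x, HHalf.toFun v x * φ x ∂volI := by
    rw [setIntegral_eq_of_subset_of_forall_sdiff_eq_zero measurableSet_Ioc
      (Ioo_subset_Ioc_self.trans (Ioc_subset_Ioc (by norm_num : (-2 : ℝ) ≤ -1)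
      (by norm_num : (1 : ℝ) ≤ 2))) fun x hx => by rw [hφ.eq_zero hx.2, mul_zero]]
    exact setIntegral_congr_fun measurableSet_Ioo fun x hx => by
      simp only [tri_of_mem_Icc (Ioo_subset_Icc_self hx)]
  have h6 : Complex.reCLM (4 * (1 / 4 * ∫ x in (-2 : ℝ)..2, (starRingEnd ℂ) (φ x : ℂ) *
      reflect v x)) = pairing hφ.memLp v := by
    rw [pairing_apply, ← h5, ← mul_assoc, intervalIntegral.integral_of_le (by norm_num)]
    simp only [h4]
    rw [integral_complex_ofReal]
    norm_num
  have h7 : ∀ n, Complex.reCLM (4 * ((starRingEnd ℂ) (fcoeff (fun x => (φ x : ℂ)) n) *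
      fcoeff (reflect v) n)) = 4 * ⟪fcoeff (fun x => (φ x : ℂ)) n, a n⟫ := fun n => by
    simp [a, Complex.inner]
    ring
  rw [h6] at h3
  exact (funext h7 : _ = fun n => 4 * ⟪fcoeff (fun x => (φ x : ℂ)) n, a n⟫) ▸ h3

/-- The operator `N'` represents the convolution with `k`, if its transpose `N` is the multiplier by
the quotient of the Fourier coefficients of `k (-x)` and of `-log |x|`. -/
theorem conv_eq_of_symbol {E : lp (fun _ : ℤ => ℂ) 2 →L[ℝ] HHalf}
    (hE : ∀ ψ, HasSum (fun n => mode n (√(logCoeff n) • ψ n)) (E ψ))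
    {k : ℝ → ℝ} (hk : LocallyIntegrable (fun x => k (-x)))
    (hmem : MemLp (fun x => (k (-x) : ℂ)) 2 (volume.restrict (Ioc (-2 : ℝ) 2)))
    {N N' : lp (fun _ : ℤ => ℂ) 2 →L[ℝ] lp (fun _ : ℤ => ℂ) 2}
    (hN : ∀ ψ n, logCoeff n * N ψ n = fcoeff (fun x => (k (-x) : ℂ)) n * ψ n)
    (hadj : ∀ ψ χ, ⟪N ψ, χ⟫ = ⟪ψ, N' χ⟫) (t : HMinusHalf) :
    conv k hk t = E (N' (dualMap E t)) := by
  refine IsConv.conv_eq fun φ hφ => ?_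
  have hφc : Continuous fun y => (φ y : ℂ) :=
    Complex.continuous_ofReal.comp hφ.smooth.continuous
  obtain ⟨c, hc, C, hL⟩ := logCoeff_bounds
  have hτ : Memℓp (fun n => √(logCoeff n) • fcoeff (fun x => (φ x : ℂ)) n) 2 := by
    refine memℓp_gen ?_
    refine Summable.of_nonneg_of_le (fun _ => by positivity) (fun n => ?_)
      ((hasSum_sq_fcoeff (memLp_period_of_continuous hφc)).summable.mul_left C)
    simp only [ENNReal.toReal_ofNat, Real.rpow_ofNat]
    rw [norm_smul, mul_pow, Real.norm_eq_abs, sq_abs, Real.sq_sqrt (logCoeff_pos n).le]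
    refine mul_le_mul_of_nonneg_right (le_trans ?_ (hL n).2) (sq_nonneg _)
    nlinarith [logCoeff_pos n, abs_nonneg (n : ℝ)]
  -- In coordinates, the functional `v ↦ ∫ v φ` is `4 τ`.
  set τ : lp (fun _ : ℤ => ℂ) 2 := ⟨_, hτ⟩ with hτ_def
  have hτn : ∀ n, τ n = √(logCoeff n) • fcoeff (fun x => (φ x : ℂ)) n := fun n => rfl
  clear_value τ
  have hpair : ∀ ψ, ∫ x, HHalf.toFun (E ψ) x * φ x ∂volI = 4 * ⟪τ, ψ⟫ := fun ψ => by
    rw [← pairing_apply hφ.memLp]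
    have h1 := (pairing hφ.memLp).hasSum (hE ψ)
    have h2 : ∀ n, pairing hφ.memLp (mode n (√(logCoeff n) • ψ n)) = 4 * ⟪τ n, ψ n⟫ :=
      fun n => by
        rw [pairing_mode hφ, hτn, real_inner_smul_left, real_inner_smul_right]
    simp only [h2] at h1
    exact h1.unique ((lp.hasSum_inner (𝕜 := ℝ) τ ψ).mul_left 4)
  have hv : HHalf.ofContDiff _ (contDiff_conv hk hφ) = E ((4 : ℝ) • N τ) := by
    refine ofContDiff_conv_eq hk hmem hφ ?_
    have hz : ∀ n, 4 * fcoeff (fun x => (k (-x) : ℂ)) n * fcoeff (fun x => (φ x : ℂ)) n =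
        √(logCoeff n) • ((4 : ℝ) • N τ) n := fun n => by
      have h1 := hN τ n
      have h2 : (√(logCoeff n) : ℂ) * √(logCoeff n) = logCoeff n := by
        rw [← Complex.ofReal_mul, Real.mul_self_sqrt (logCoeff_pos n).le]
      have h3 : (√(logCoeff n) : ℂ) ≠ 0 :=
        Complex.ofReal_ne_zero.2 (Real.sqrt_pos.2 (logCoeff_pos n)).ne'
      rw [lp.coeFn_smul, Pi.smul_apply]
      rw [hτn] at h1
      simp only [Complex.real_smul] at h1 ⊢
      push_cast
      refine mul_left_cancel₀ h3 ?_
      linear_combination (-4 : ℂ) * h1 - 4 * N τ n * h2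
    simp only [hz]
    exact hE _
  rw [hpair, hv, ← hadj, ← inner_dualMap E t ((4 : ℝ) • N τ), real_inner_smul_right,
    real_inner_comm]

/-- For a suitable synthesis operator `E` on a Hilbert space, the convolution with `-log |x|` is
`E Eᵗ`, and the convolution with `sgn x` is `E M Eᵗ` with a skew operator `M`. -/
theorem exists_kernel_representation :
    ∃ (F : Type) (_ : NormedAddCommGroup F) (_ : InnerProductSpace ℝ F) (_ : CompleteSpace F)
      (E : F →L[ℝ] HHalf) (M : F →L[ℝ] F),
      Function.Surjective E ∧ (∀ ψ, ⟪M ψ, ψ⟫ = 0) ∧ ∀ t : HMinusHalf,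
        conv logKernel locallyIntegrable_logKernel_neg t = -E (dualMap E t) ∧
        conv sgnKernel locallyIntegrable_sgnKernel_neg t = E (M (dualMap E t)) := by
  obtain ⟨E, hsurj, hE⟩ := exists_log_synthesis
  obtain ⟨c, hc, C, hL⟩ := logCoeff_bounds
  have hpos : ∀ n : ℤ, 0 < 1 + |(n : ℝ)| := fun n => by positivity
  obtain ⟨M, hM⟩ := exists_multiplier
    (fun n => ((sgnCoeff n / logCoeff n : ℝ) : ℂ) * Complex.I) (C := 2 / c) fun n => by
      rw [norm_mul, Complex.norm_I, mul_one, Complex.norm_real, Real.norm_eq_abs, abs_div,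
        abs_of_pos (logCoeff_pos n), ← mul_div_mul_left _ _ (hpos n).ne']
      exact div_le_div₀ (by norm_num) (abs_sgnCoeff_le n) hc (hL n).1
  have hskew : ∀ ψ χ, ⟪M ψ, χ⟫ = -⟪ψ, M χ⟫ := fun ψ χ => by
    rw [lp.inner_eq_tsum, lp.inner_eq_tsum, ← tsum_neg]
    refine tsum_congr fun n => ?_
    rw [hM, hM, Complex.inner, Complex.inner, ← Complex.neg_re]
    congr 1
    simp only [map_mul, Complex.conj_ofReal, Complex.conj_I]
    ring
  refine ⟨_, _, _, inferInstance, E, M, hsurj, fun ψ => ?_, fun t => ⟨?_, ?_⟩⟩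
  · have h := hskew ψ ψ
    rw [real_inner_comm (M ψ) ψ] at h
    linarith
  · have hlog : ∀ x, logKernel (-x) = logKernel x := fun x => by simp [logKernel]
    rw [conv_eq_of_symbol hE (N := -ContinuousLinearMap.id ℝ _)
      (N' := -ContinuousLinearMap.id ℝ _)]
    · simp
    · simpa only [hlog] using memLp_logKernel
    · intro ψ n
      simp only [hlog, fcoeff_logKernel]
      simp
    · simp
  · have hsgn : ∀ x, sgnKernel (-x) = -sgnKernel x := fun x => by simp [sgnKernel, Real.sign_neg]
    refine conv_eq_of_symbol hE _ (N := -M) ?_ (fun ψ n => ?_) (fun ψ χ => ?_) t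
    · simp only [hsgn, Complex.ofReal_neg]
      exact memLp_sgnKernel.neg
    · have h1 : fcoeff (fun y => (sgnKernel (-y) : ℂ)) n = -((sgnCoeff n : ℂ) * Complex.I) := by
        rw [← fcoeff_sgnKernel]
        simp only [fcoeff, hsgn, Complex.ofReal_neg, mul_neg, intervalIntegral.integral_neg]
      have h2 : (logCoeff n : ℂ) ≠ 0 := Complex.ofReal_ne_zero.2 (logCoeff_pos n).ne'
      rw [h1, neg_apply, lp.coeFn_neg, Pi.neg_apply, hM]
      push_cast
      field_simp
    · rw [neg_apply, inner_neg_left, hskew, neg_neg]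

/-! ### The sliding form -/

/-- A nonpositive functional that vanishes at the constant function `1` vanishes at all bounded
functions, in particular at those which determine its convolutions. -/
theorem HMinusHalf.Nonpos.conv_eq_zero {t : HMinusHalf} (ht : t.Nonpos)
    (h1 : t (HHalf.ofContDiff (fun _ => 1) contDiff_const) = 0) (k : ℝ → ℝ)
    (hk : LocallyIntegrable (fun x => k (-x))) : conv k hk t = 0 := by
  refine IsConv.conv_eq fun φ hφ => ?_
  have h0 : ∫ x, HHalf.toFun 0 x * φ x ∂volI = 0 := by
    rw [← pairing_apply hφ.memLp, map_zero]
  rw [h0]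
  have hc := contDiff_conv hk hφ
  obtain ⟨C, hC⟩ := (isCompact_Icc (a := (-1 : ℝ)) (b := 1)).exists_bound_of_continuousOn
    hc.continuous.continuousOn
  refine (ht.eq_zero_of_bounded h1 (M := C) ?_).symm
  filter_upwards [HHalf.toFun_ofContDiff _ hc, ae_restrict_mem measurableSet_Ioo] with x hx hx'
  rw [hx]
  exact hC x (Ioo_subset_Icc_self hx')

theorem isClosed_nonpos : IsClosed {t : HMinusHalf | t.Nonpos} := by
  have h : {t : HMinusHalf | t.Nonpos} =
      ⋂ (v : HHalf) (_ : ∀ᵐ x ∂volI, 0 ≤ HHalf.toFun v x), {t | t v ≤ 0} := by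
    ext t
    simp [HMinusHalf.Nonpos]
  rw [h]
  exact isClosed_iInter fun v => isClosed_iInter fun _ =>
    isClosed_le (ContinuousLinearMap.apply ℝ ℝ v).continuous continuous_const

theorem convex_nonpos : Convex ℝ {t : HMinusHalf | t.Nonpos} := by
  intro t ht s hs a b ha hb _ v hv
  have h1 := mul_nonpos_of_nonneg_of_nonpos ha (ht v hv)
  have h2 := mul_nonpos_of_nonneg_of_nonpos hb (hs v hv)
  simpa using add_nonpos h1 h2

theorem nonpos_zero : HMinusHalf.Nonpos 0 := fun _ _ => le_rfl

theorem HMinusHalf.Nonpos.two_smul {t : HMinusHalf} (ht : t.Nonpos) :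
    HMinusHalf.Nonpos ((2 : ℝ) • t) := fun v hv => by
  have := ht v hv
  simp only [smul_apply, smul_eq_mul]
  linarith

set_option maxHeartbeats 1000000 in
/-- In the coordinates given by `Eᵗ`, the form `a(t₁,t₂)` is a multiple of the inner product plus a skew
form. -/
theorem exists_formSliding_eq :
    ∃ (F : Type) (_ : NormedAddCommGroup F) (_ : InnerProductSpace ℝ F) (_ : CompleteSpace F)
      (E : F →L[ℝ] HHalf) (M : F →L[ℝ] F),
      Function.Surjective E ∧ (∀ ψ, ⟪M ψ, ψ⟫ = 0) ∧
      (∀ t s, formS t s = ⟪dualMap E t, dualMap E s⟫) ∧ ∀ Λ f w t s, formSliding Λ f w t s =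
        ((constants Λ).c₁ - Real.sign w * f * (constants Λ).c₂) * ⟪dualMap E t, dualMap E s⟫ +
        Real.sign w * f * (constants Λ).c₃ * ⟪M (dualMap E t), dualMap E s⟫ := by
  obtain ⟨F, _, _, _, E, M, hE, hM, h⟩ := exists_kernel_representation
  have hS : ∀ t s, formS t s = ⟪dualMap E t, dualMap E s⟫ := fun t s => by
    rw [formS, (h t).1, map_neg, neg_neg]
    exact apply_eq_inner_dualMap E s (dualMap E t)
  refine ⟨F, _, _, _, E, M, hE, hM, hS, fun Λ f w t s => ?_⟩
  have hA : formA t s = ⟪M (dualMap E t), dualMap E s⟫ := by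
    rw [formA, (h t).2]
    exact apply_eq_inner_dualMap E s (M (dualMap E t))
  rw [formSliding, hS, hA]

theorem existsUnique_solution (Λ : SymMat →ₗ[ℝ] SymMat) {f w : ℝ}
    (hpos : 0 < (constants Λ).c₁ - Real.sign w * f * (constants Λ).c₂) (g : HHalf) :
    ∃! t : HMinusHalf, SolvesProblem Λ f w g t := by
  obtain ⟨F, _, _, _, E, M, hE, hM, -, hform⟩ := exists_formSliding_eq
  have key := existsUnique_variationalInequality_dual E hE hM ⟨0, nonpos_zero⟩ isClosed_nonpos
    convex_nonpos hpos (Real.sign w * f * (constants Λ).c₃) g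
  simp only [← hform Λ f w] at key
  exact key

set_option maxHeartbeats 1000000 in
/-- If the symmetric part of the form is nonpositive, then an indentor with the constant shape `-1`
admits no solution: testing with `0` and `2 t` gives `a(t,t) = -⟨1,t⟩ ≥ 0`, so that `⟨1,t⟩ = 0`, which
forces `t = 0`; but `t = 0` is not a solution. -/
theorem not_exists_solution (Λ : SymMat →ₗ[ℝ] SymMat) {f w : ℝ}
    (hneg : (constants Λ).c₁ - Real.sign w * f * (constants Λ).c₂ ≤ 0) :
    ¬ ∃ t : HMinusHalf, SolvesProblem Λ f w
      (HHalf.ofContDiff (fun _ => -1) contDiff_const) t := by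
  rintro ⟨t, ht, h⟩
  obtain ⟨F, _, _, _, E, M, -, hM, hS, hform⟩ := exists_formSliding_eq
  set g := HHalf.ofContDiff (fun _ : ℝ => (-1 : ℝ)) contDiff_const
  set o := HHalf.ofContDiff (fun _ : ℝ => (1 : ℝ)) contDiff_const
  have hg : HHalf.toFun g =ᵐ[volI] fun _ => -1 := HHalf.toFun_ofContDiff _ _
  have ho : HHalf.toFun o =ᵐ[volI] fun _ => 1 := HHalf.toFun_ofContDiff _ _
  have hgo : g = -o := HHalf.ext_ae <| by
    filter_upwards [hg, ho, Lp.coeFn_neg o.1.fst] with x h1 h2 h3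
    rw [h1]
    refine Eq.trans ?_ h3.symm
    rw [Pi.neg_apply]
    change _ = -HHalf.toFun o x
    rw [h2]
  have hsq : formSliding Λ f w t t ≤ 0 := by
    rw [hform, hM, mul_zero, add_zero, real_inner_self_eq_norm_sq]
    exact mul_nonpos_of_nonpos_of_nonneg hneg (sq_nonneg _)
  have hto : t o ≤ 0 := ht o (by filter_upwards [ho] with x hx; rw [hx]; exact zero_le_one)
  have h2 := h _ ht.two_smul
  have ht2 : (2 : ℝ) • t - t = t := by module
  rw [ht2, hgo, map_neg] at h2
  have hto0 : t o = 0 := by linarith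
  have hR : dualMap E t = 0 := by
    have h0 : formS t t = 0 := by rw [formS, ht.conv_eq_zero hto0, map_zero, neg_zero]
    rw [hS] at h0
    exact inner_self_eq_zero.1 h0
  -- The functional `-∫ v` is admissible, and pairs positively with the shape `-1`.
  have hone : MemLp (fun _ : ℝ => (1 : ℝ)) 2 volI := memLp_of_contDiff contDiff_const
  have hs : HMinusHalf.Nonpos (-pairing hone) := fun v hv => by
    rw [neg_apply, pairing_apply, neg_nonpos]
    exact integral_nonneg_of_ae (by filter_upwards [hv] with x hx; simpa using hx)
  have h3 := h _ hs
  rw [hform, hR, map_zero, inner_zero_left, mul_zero, mul_zero, add_zero,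
    sub_apply, hgo, map_neg, map_neg, hto0, neg_apply,
    pairing_apply] at h3
  have h4 : ∫ x, HHalf.toFun o x * 1 ∂volI = 2 := by
    rw [integral_congr_ae (g := fun _ => (1 : ℝ)) (by filter_upwards [ho] with x hx; rw [hx, mul_one])]
    simp
    norm_num
  rw [h4] at h3
  norm_num at h3

end SteadySliding

end

theorem mainTheorem6
    (Λ : SymMat →ₗ[ℝ] SymMat)
    (hsymm : ∀ A B : SymMat, frob A (Λ B) = frob B (Λ A))
    (hell : ∃ α : ℝ, 0 < α ∧ ∀ A : SymMat, α * frob A A ≤ frob A (Λ A))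
    (f : ℝ) (hf : 0 ≤ f) :
    (0 < (constants Λ).c₁ - f * |(constants Λ).c₂| →
      ∀ w : ℝ, w ≠ 0 → ∀ g : HHalf, ∃! t : HMinusHalf, SolvesProblem Λ f w g t) ∧
    ((constants Λ).c₁ - f * |(constants Λ).c₂| ≤ 0 →
      ∀ w : ℝ, w ≠ 0 → Real.sign w * (constants Λ).c₂ = |(constants Λ).c₂| →
        ∃ (g : ℝ → ℝ) (hg : ContDiff ℝ ∞ g), ¬ ∃ t : HMinusHalf,
          SolvesProblem Λ f w (HHalf.ofContDiff g (hg.of_le (mod_cast le_top))) t) := by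
  refine ⟨fun hpos w _ g => existsUnique_solution Λ (hpos.trans_le ?_) g, fun hneg w _ hw =>
    ⟨fun _ => -1, contDiff_const, not_exists_solution Λ ?_⟩⟩
  · have hsign : |Real.sign w| ≤ 1 := by
      obtain h | h | h := Real.sign_apply_eq w <;> simp [h]
    have h1 : Real.sign w * (constants Λ).c₂ ≤ |(constants Λ).c₂| := by
      refine (le_abs_self _).trans ?_
      rw [abs_mul]
      exact mul_le_of_le_one_left (abs_nonneg _) hsign
    have h2 := mul_le_mul_of_nonneg_left h1 hf
    linarith
  · rw [mul_right_comm, hw]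
    linarith
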